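/- **Setting.** Let $\Sigma$ be a finite set of events and $\checkmark\notin\Sigma$. Let $\Sigma^{*\checkmark}$ be the set of finite sequences over $\Sigma$ which may end with $\checkmark$, and $\Sigma^*$ the set of those without $\checkmark$. CSP terms are given by $$P ::= \mathrm{STOP}\mid a\to P\mid \mathrm{SKIP}\mid P_1\sqcap P_2\mid P_1\,\square\,P_2\mid P_1\parallel_A P_2\mid P_1;P_2\mid P\setminus A\mid P[R]\mid X\mid \mu X.\,P\mid \mathrm{DIV},$$ where $a\in\Sigma$, $A\subseteq\Sigma$, $R$ is a binary relation on $\Sigma$ and $X$ is a process variable; $\mu X$ binds $X$. A term is closed if it has no free variables, and open otherwise. **Model.** $\mathcal T^{\Downarrow}$ is the set of pairs $(T,D)$ of subsets of $\Sigma^{*\checkmark}$ such that $D\subseteq T$; $s\langle\checkmark\rangle\in D$ implies $s\in D$; $T$ is non-empty and prefix-closed; and $s\in D\cap\Sigma^*$, $t\in\Sigma^{*\checkmark}$ imply $st\in D$. It is a complete lattice under $(T_1,D_1)\sqsubseteq(T_2,D_2)\iff T_2\subseteq T_1\wedge D_2\subseteq D_1$. A term with free variables among $X_1,\dots,X_n$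 is interpreted as a monotone map $(\mathcal T^{\Downarrow})^n\to\mathcal T^{\Downarrow}$, the variable $X_i$ standing for the $i$-th argument, as follows. Here $T_P,D_P$ are the components of $P$, $r$ ranges over $\Sigma^{*\checkmark}$, an infinite trace of $P$ is a $u\in\Sigma^\omega$ all of whose finite prefixes are in $T_P$, $s\setminus A$ is $s$ with all events of $A$ deleted, $s\,R\,t$ means that $s,t$ have equal length and are related element-wise ($\checkmark$ being related exactly to itself), and $s\parallel_A t$ is the set of interleavings of $s$ and $t$ that synchronise on exactly the events of $A\cup\{\checkmark\}$. The set $T$ is always the union of $D$ with the set displayed. * $\mathrm{STOP}$: $D=\emptyset$, $\{\langle\rangle\}$. $\mathrm{SKIP}$: $D=\emptyset$, $\{\langle\rangle,\langle\checkmark\rangle\}$. $\mathrm{DIV}$: $D=\Sigma^{*\checkmark}$. * $a\to P$: $D=\{\langle a\rangle t: t\in D_P\}$; $\{\langle\rangle\}\cup\{\langle a\rangle t:t\in T_P\}$. * $P\sqcap Q$ and $P\,\square\,Q$: $D=D_P\cup D_Q$; $T_P\cup T_Q$. * $P;Q$: $D=D_P\cup\{ts: t\langle\checkmark\rangle\in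 T_P,\ s\in D_Q\}$; $(T_P\cap\Sigma^*)\cup\{ts:t\langle\checkmark\rangle\in T_P,\ s\in T_Q\}$. * $P\setminus A$: $D=\{(t\setminus A)r: t\in D_P\cap\Sigma^*\}\cup\{(u\setminus A)r: u \text{ an infinite trace of } P \text{ with } u\setminus A\text{ finite}\}$; $\{t\setminus A:t\in T_P\}$. * $P[R]$: $D=\{tr:\exists s\in D_P\cap\Sigma^*,\ s\,R\,t\}$; $\{t:\exists s\in T_P,\ s\,R\,t\}$. * $P\parallel_A Q$: $D=\{ur: \exists s\in T_P,\,t\in T_Q,\ u\in (s\parallel_A t)\cap\Sigma^*,\ (s\in D_P\text{ or }t\in D_Q)\}$; $\bigcup\{s\parallel_A t:s\in T_P,\,t\in T_Q\}$. * $\mu X.\,P$: the least fixed point (for $\sqsubseteq$) of $P$ as a function of $X$, the other variables being fixed. A process $(T,D)\in\mathcal T^{\Downarrow}$ is *livelock-free* if $D=\emptyset$, and *$W$-fair*, for $W\subseteq\Sigma$, if each of its infinite traces contains infinitely many events from $W$. **Static analysis.** Write $R(U)=\{y:\exists x\in U,\ x\,R\,y\}$, and let $U,V,U',V',U_i,V_i,W$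 range over subsets of $\Sigma$; variables that occur only in the condition of a set are existentially quantified. Define $\mathcal N_X(P)$, $\mathcal G(P)$, $\mathcal C_X(P)$, $\mathcal F(P)$ by recursion on $P$. If $X$ is not free in $P$, then $\mathcal N_X(P)=\mathcal C_X(P)=\mathcal P(\Sigma)\times\mathcal P(\Sigma)$. Otherwise: * $\mathcal N_X(a\to P)=\mathcal N_X(P)$; $\mathcal N_X(P_1\oplus P_2)=\mathcal N_X(P_1)\cap\mathcal N_X(P_2)$ for $\oplus\in\{\sqcap,\square,;,\parallel_A\}$; $\mathcal N_X(P\setminus A)=\{(U,V):(U,V')\in\mathcal N_X(P),\ V'\cap A=\emptyset,\ V'\subseteq V\}$; $\mathcal N_X(P[R])=\{(U,V):(U,V')\in\mathcal N_X(P),\ R(V')\subseteq V\}$; $\mathcal N_X(X)=\{(U,V):U\subseteq V\}$; $\mathcal N_X(\mu Y.P)=\{(U,V):(U',V')\in\mathcal N_X(P),\ (V',V')\in\mathcal N_Y(P),\ U\subseteq U',\ V'\subseteq V\}$ for $Y\ne X$. * $\mathcal C_X(a\to P)=\mathcal C_X(P)\cup\{(U,V)\in\mathcal N_X(P):a\in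 V\}$; $\mathcal C_X(P_1\oplus P_2)=\mathcal C_X(P_1)\cap\mathcal C_X(P_2)$ for $\oplus\in\{\sqcap,\square,\parallel_A\}$; $\mathcal C_X(P_1;P_2)=\mathcal C_X(P_1)\cap(\mathcal C_X(P_2)\cup\{(U,V)\in\mathcal N_X(P_2):V\in\mathcal G(P_1)\})$; $\mathcal C_X(P\setminus A)=\{(U,V):(U,V')\in\mathcal C_X(P),\ V'\cap A=\emptyset,\ V'\subseteq V\}$; $\mathcal C_X(P[R])=\{(U,V):(U,V')\in\mathcal C_X(P),\ R(V')\subseteq V\}$; $\mathcal C_X(X)=\emptyset$; $\mathcal C_X(\mu Y.P)=\{(U,V):(U',V')\in\mathcal C_X(P),\ (V',V')\in\mathcal N_Y(P),\ U\subseteq U',\ V'\subseteq V\}$ for $Y\neq X$. For all terms: * $\mathcal G(\mathrm{STOP})=\mathcal P(\Sigma)$; $\mathcal G(\mathrm{SKIP})=\mathcal G(X)=\mathcal G(\mathrm{DIV})=\emptyset$; $\mathcal G(a\to P)=\mathcal G(P)\cup\{V:a\in V\}$; $\mathcal G(P_1\oplus P_2)=\mathcal G(P_1)\cap\mathcal G(P_2)$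 for $\oplus\in\{\sqcap,\square\}$; $\mathcal G(P_1;P_2)=\mathcal G(P_1)\cup\mathcal G(P_2)$ if $P_1$ is closed and $\mathcal F(P_1)\neq\emptyset$, and $\mathcal G(P_1)$ otherwise; $\mathcal G(P_1\parallel_A P_2)=\mathcal G(P_1)\cup\mathcal G(P_2)$ if $P_1,P_2$ are closed and $\mathcal F(P_1),\mathcal F(P_2)\ne\emptyset$, and $\mathcal G(P_1)\cap\mathcal G(P_2)$ otherwise; $\mathcal G(P\setminus A)=\{V:V'\in\mathcal G(P),\ V'\cap A=\emptyset,\ V'\subseteq V\}$ if $P$ is closed and $(\emptyset,\Sigma\setminus A)\in\mathcal F(P)$, and $\emptyset$ otherwise; $\mathcal G(P[R])=\{V:V'\in\mathcal G(P),\ R(V')\subseteq V\}$; $\mathcal G(\mu X.P)=\mathcal G(P)$. * $\mathcal F(\mathrm{STOP})=\mathcal F(\mathrm{SKIP})=\mathcal P(\Sigma)\times\mathcal P(\Sigma)$; $\mathcal F(\mathrm{DIV})=\emptyset$; $\mathcal F(a\to P)=\mathcal F(P)$; $\mathcal F(P_1\oplus P_2)=\mathcal F(P_1)\cap\mathcal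 F(P_2)$ for $\oplus\in\{\sqcap,\square,;\}$; $\mathcal F(P_1\parallel_A P_2)=(\mathcal F(P_1)\cap\mathcal F(P_2))\cup\{(U_1\cap U_2,V_1):(U_1,V_1)\in\mathcal F(P_1),\ (U_2,A)\in\mathcal F(P_2)\}\cup\{(U_1\cap U_2,V_2):(U_2,V_2)\in\mathcal F(P_2),\ (U_1,A)\in\mathcal F(P_1)\}$; $\mathcal F(P\setminus A)=\{(U,V):(U,V')\in\mathcal F(P),\ V'\cap A=\emptyset,\ V'\subseteq V\}$; $\mathcal F(P[R])=\{(U,V):(U,V')\in\mathcal F(P),\ R(V')\subseteq V\}$; $\mathcal F(X)=\{(U,V):U\subseteq V\}$; $\mathcal F(\mu X.P)=\{(U,V):(W,W)\in\mathcal C_X(P)\cap\mathcal F(P),\ U\subseteq W\subseteq V\}$ if $\mu X.P$ is open, and $\{(U,V):(W,W)\in\mathcal C_X(P)\cap\mathcal F(P),\ W\subseteq V\}$ if $\mu X.P$ is closed. **Proposition.** Let $P(X_1,\dots,X_n)$ be a CSP term whose free variables are contained in $\{X_1,\dots,X_n\}$, with $X_1,\dots,X_n$ distinct. If $(U,V)\in\mathcal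 F(P)$, then for all livelock-free, $U$-fair processes $\theta_1,\dots,\theta_n\in\mathcal T^{\Downarrow}$, the process $P(\theta_1,\dots,\theta_n)$ is livelock-free and $V$-fair. -/

import Mathlib

/-!
Terms of the process algebra CSP over an alphabet `E` of events (the set written `Σ` on paper),
the traces-and-divergences model, the interpretation of terms in it, and the four families of
sets (nonexpansive, guard, contractive, fair) computed by recursion on terms.
-/

namespace CSP

/-! ### Traces -/

/-- A finite sequence of events which may end with the termination signal `✓`: the trace
consists of `events`, followed by `✓` if and only if `tick = true`.  The type of all traces is
`Σ^{*✓}`, and the traces with `tick = false` form `Σ^*`. -/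
@[ext]
structure Trace (E : Type*) where
  events : List E
  tick : Bool

namespace Trace

variable {E : Type*}

/-- The empty trace `⟨⟩`. -/
def nil : Trace E := ⟨[], false⟩

/-- Concatenation `s ⌢ t` of a trace `s` without `✓` and an arbitrary trace `t`. -/
def app (s : List E) (t : Trace E) : Trace E := ⟨s ++ t.events, t.tick⟩

/-- The (non-strict) prefix order on traces. -/
def IsPrefix (s t : Trace E) : Prop :=
  s = t ∨ (s.tick = false ∧ s.events <+: t.events)

/-- Removal of all events of `A` from a sequence of events. -/
noncomputable def hideList (A : Set E) (s : List E) : List E :=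
  open Classical in s.filter (fun a => decide (a ∉ A))

/-- `Interleave A s t u`: the sequence `u` of events is an interleaving of `s` and `t` that
synchronises on exactly the events of `A`. -/
inductive Interleave (A : Set E) : List E → List E → List E → Prop
  | nil : Interleave A [] [] []
  | sync {a : E} {s t u : List E} (ha : a ∈ A) (h : Interleave A s t u) :
      Interleave A (a :: s) (a :: t) (a :: u)
  | left {b : E} {s t u : List E} (hb : b ∉ A) (h : Interleave A s t u) :
      Interleave A (b :: s) t (b :: u)
  | right {b : E} {s t u : List E} (hb : b ∉ A) (h : Interleave A s t u) :
      Interleave A s (b :: t) (b :: u)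

/-- `u ∈ s ∥_A t` for traces: synchronisation on the events of `A` and on `✓`. -/
def Par (A : Set E) (s t u : Trace E) : Prop :=
  Interleave A s.events t.events u.events ∧ s.tick = u.tick ∧ t.tick = u.tick

/-- The prefix of length `n` of an infinite sequence of events. -/
def initSeg (u : ℕ → E) (n : ℕ) : List E := (List.range n).map u

/-- A prefix of `u ⌢ r` is a prefix of `u` or of the form `u ⌢ r'`. -/
theorem isPrefix_app {x r : Trace E} {u : List E} (h : IsPrefix x (app u r)) :
    (x.tick = false ∧ x.events <+: u) ∨ ∃ r', x = app u r' ∧ IsPrefix r' r := by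
  rcases h with rfl | ⟨h1, h2⟩
  · exact Or.inr ⟨r, rfl, Or.inl rfl⟩
  · rcases List.prefix_or_prefix_of_prefix h2 (List.prefix_append u r.events) with h3 | ⟨v, hv⟩
    · exact Or.inl ⟨h1, h3⟩
    · refine Or.inr ⟨⟨v, false⟩, ?_, Or.inr ⟨rfl, ?_⟩⟩
      · ext1
        · exact hv.symm
        · exact h1
      · rw [← hv] at h2
        exact (List.prefix_append_right_inj u).mp h2

theorem isPrefix_nil {x : Trace E} (h : IsPrefix x nil) : x = nil := by
  rcases h with rfl | ⟨h1, h2⟩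
  · rfl
  · ext1
    · exact List.prefix_nil.mp h2
    · exact h1

theorem app_app (s t : List E) (r : Trace E) : app (s ++ t) r = app s (app t r) := by
  simp [app]

theorem Interleave.prefix {A : Set E} {s t u : List E} (h : Interleave A s t u) :
    ∀ u', u' <+: u → ∃ s' t', s' <+: s ∧ t' <+: t ∧ Interleave A s' t' u' := by
  induction h with
  | nil =>
    intro u' hu
    obtain rfl := List.prefix_nil.mp hu
    exact ⟨[], [], List.nil_prefix, List.nil_prefix, .nil⟩
  | @sync a s t u ha h ih =>
    intro u' hu
    rcases List.prefix_cons_iff.mp hu with rfl | ⟨v, rfl, hv⟩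
    · exact ⟨[], [], List.nil_prefix, List.nil_prefix, .nil⟩
    · obtain ⟨s', t', hs, ht, hi⟩ := ih v hv
      exact ⟨a :: s', a :: t', List.cons_prefix_cons.mpr ⟨rfl, hs⟩,
        List.cons_prefix_cons.mpr ⟨rfl, ht⟩, .sync ha hi⟩
  | @left a s t u ha h ih =>
    intro u' hu
    rcases List.prefix_cons_iff.mp hu with rfl | ⟨v, rfl, hv⟩
    · exact ⟨[], [], List.nil_prefix, List.nil_prefix, .nil⟩
    · obtain ⟨s', t', hs, ht, hi⟩ := ih v hv
      exact ⟨a :: s', t', List.cons_prefix_cons.mpr ⟨rfl, hs⟩, ht, .left ha hi⟩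
  | @right a s t u ha h ih =>
    intro u' hu
    rcases List.prefix_cons_iff.mp hu with rfl | ⟨v, rfl, hv⟩
    · exact ⟨[], [], List.nil_prefix, List.nil_prefix, .nil⟩
    · obtain ⟨s', t', hs, ht, hi⟩ := ih v hv
      exact ⟨s', a :: t', hs, List.cons_prefix_cons.mpr ⟨rfl, ht⟩, .right ha hi⟩

theorem hideList_prefix {A : Set E} {x s : List E} (h : x <+: hideList A s) :
    ∃ s', s' <+: s ∧ x = hideList A s' := by
  classical
  induction s generalizing x with
  | nil => exact ⟨[], List.nil_prefix, List.prefix_nil.mp h⟩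
  | cons a s ih =>
    by_cases ha : a ∈ A
    · have h' : x <+: hideList A s := by simpa [hideList, ha] using h
      obtain ⟨s', h1, h2⟩ := ih h'
      exact ⟨a :: s', List.cons_prefix_cons.mpr ⟨rfl, h1⟩, by simpa [hideList, ha] using h2⟩
    · have h' : x <+: a :: hideList A s := by simpa [hideList, ha] using h
      rcases List.prefix_cons_iff.mp h' with rfl | ⟨v, rfl, hv⟩
      · exact ⟨[], List.nil_prefix, rfl⟩
      · obtain ⟨s', h1, h2⟩ := ih hv
        refine ⟨a :: s', List.cons_prefix_cons.mpr ⟨rfl, h1⟩, ?_⟩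
        rw [h2]
        simp [hideList, ha]

theorem forall₂_prefix {R : E → E → Prop} {s t x : List E} (h : List.Forall₂ R s t)
    (hx : x <+: t) : ∃ s', s' <+: s ∧ List.Forall₂ R s' x := by
  induction h generalizing x with
  | nil =>
    obtain rfl := List.prefix_nil.mp hx
    exact ⟨[], List.nil_prefix, .nil⟩
  | @cons a b s t hab h ih =>
    rcases List.prefix_cons_iff.mp hx with rfl | ⟨v, rfl, hv⟩
    · exact ⟨[], List.nil_prefix, .nil⟩
    · obtain ⟨s', h1, h2⟩ := ih hv
      exact ⟨a :: s', List.cons_prefix_cons.mpr ⟨rfl, h1⟩, .cons hab h2⟩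

end Trace

/-! ### The traces-and-divergences model -/

/-- An element `(T, D)` of the semantic domain: `T` is the set of traces (including all
divergences), `D` the set of divergences. -/
@[ext]
structure Proc (E : Type*) where
  T : Set (Trace E)
  D : Set (Trace E)
  D_subset : D ⊆ T
  D_of_tick : ∀ s : List E, (⟨s, true⟩ : Trace E) ∈ D → (⟨s, false⟩ : Trace E) ∈ D
  T_nonempty : T.Nonempty
  T_prefix : ∀ s t : Trace E, s.IsPrefix t → t ∈ T → s ∈ T
  D_extend : ∀ (s : List E) (t : Trace E), (⟨s, false⟩ : Trace E) ∈ D → Trace.app s t ∈ D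

namespace Proc

open Trace

variable {E : Type*}

theorem nil_mem (P : Proc E) : Trace.nil ∈ P.T := by
  obtain ⟨t, ht⟩ := P.T_nonempty
  exact P.T_prefix _ t (Or.inr ⟨rfl, List.nil_prefix⟩) ht

/-- `P ⊑ Q`: reverse inclusion on traces and on divergences. -/
instance : PartialOrder (Proc E) where
  le P Q := Q.T ⊆ P.T ∧ Q.D ⊆ P.D
  le_refl _ := ⟨subset_rfl, subset_rfl⟩
  le_trans _ _ _ h k := ⟨k.1.trans h.1, k.2.trans h.2⟩
  le_antisymm _ _ h k := Proc.ext (subset_antisymm k.1 h.1) (subset_antisymm k.2 h.2)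

theorem le_def {P Q : Proc E} : P ≤ Q ↔ Q.T ⊆ P.T ∧ Q.D ⊆ P.D := Iff.rfl

/-- Least upper bounds are intersections. -/
instance : SupSet (Proc E) where
  sSup S :=
    { T := {s | ∀ P ∈ S, s ∈ P.T}
      D := {s | ∀ P ∈ S, s ∈ P.D}
      D_subset := fun _ h P hP => P.D_subset (h P hP)
      D_of_tick := fun s h P hP => P.D_of_tick s (h P hP)
      T_nonempty := ⟨Trace.nil, fun P _ => P.nil_mem⟩
      T_prefix := fun s t hst ht P hP => P.T_prefix s t hst (ht P hP)
      D_extend := fun s t h P hP => P.D_extend s t (h P hP) }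

/-- The semantic domain is a complete lattice; its bottom element has all traces and all
divergences. -/
instance : CompleteLattice (Proc E) :=
  completeLatticeOfSup (Proc E) fun _ =>
    ⟨fun P hP => ⟨fun _ hs => hs P hP, fun _ hs => hs P hP⟩,
     fun _ hQ => ⟨fun _ hs _ hP => (hQ hP).1 hs, fun _ hs _ hP => (hQ hP).2 hs⟩⟩

/-- A process is livelock-free if it has no divergences. -/
def LivelockFree (P : Proc E) : Prop := P.D = ∅

/-- The infinite traces: sequences all of whose finite prefixes are traces. -/
def infTraces (P : Proc E) : Set (ℕ → E) :=
  {u | ∀ n, (⟨initSeg u n, false⟩ : Trace E) ∈ P.T}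

/-- A process is `W`-fair if each of its infinite traces contains infinitely many events
from `W`. -/
def Fair (W : Set E) (P : Proc E) : Prop :=
  ∀ u ∈ P.infTraces, {n | u n ∈ W}.Infinite

/-! ### The operators on the semantic domain -/

def STOP : Proc E where
  T := {Trace.nil}
  D := ∅
  D_subset := Set.empty_subset _
  D_of_tick := fun _ h => h
  T_nonempty := ⟨_, rfl⟩
  T_prefix := by
    rintro s t hst rfl
    exact isPrefix_nil hst
  D_extend := fun _ _ h => h.elim

def SKIP : Proc E where
  T := {Trace.nil, ⟨[], true⟩}
  D := ∅
  D_subset := Set.empty_subset _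
  D_of_tick := fun _ h => h
  T_nonempty := ⟨_, Or.inl rfl⟩
  T_prefix := by
    rintro s t hst (rfl | rfl)
    · exact Or.inl (isPrefix_nil hst)
    · rcases hst with rfl | ⟨h1, h2⟩
      · exact Or.inr rfl
      · exact Or.inl (isPrefix_nil (Or.inr ⟨h1, h2⟩))
  D_extend := fun _ _ h => h.elim

def DIV : Proc E where
  T := Set.univ
  D := Set.univ
  D_subset := subset_rfl
  D_of_tick := fun _ _ => trivial
  T_nonempty := ⟨Trace.nil, trivial⟩
  T_prefix := fun _ _ _ _ => trivial
  D_extend := fun _ _ _ => trivial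

/-- `a → P`. -/
def pre (a : E) (P : Proc E) : Proc E where
  T := {Trace.nil} ∪ {x | ∃ t ∈ P.T, x = app [a] t}
  D := {x | ∃ t ∈ P.D, x = app [a] t}
  D_subset := fun _ ⟨t, ht, hx⟩ => Or.inr ⟨t, P.D_subset ht, hx⟩
  D_of_tick := by
    rintro s ⟨⟨t, b⟩, ht, hx⟩
    obtain ⟨rfl, rfl⟩ := Trace.mk.inj hx
    exact ⟨⟨t, false⟩, P.D_of_tick t ht, rfl⟩
  T_nonempty := ⟨Trace.nil, Or.inl rfl⟩
  T_prefix := by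
    rintro s t hst (rfl | ⟨t, ht, rfl⟩)
    · exact Or.inl (isPrefix_nil hst)
    · rcases isPrefix_app hst with ⟨h1, h2⟩ | ⟨r, rfl, hr⟩
      · rcases List.prefix_cons_iff.mp h2 with h3 | ⟨v, h3, hv⟩
        · exact Or.inl (Trace.ext h3 h1)
        · obtain rfl := List.prefix_nil.mp hv
          exact Or.inr ⟨Trace.nil, P.nil_mem, Trace.ext h3 h1⟩
      · exact Or.inr ⟨r, P.T_prefix _ _ hr ht, rfl⟩
  D_extend := by
    rintro s t ⟨⟨r, b⟩, hr, hx⟩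
    obtain ⟨rfl, rfl⟩ := Trace.mk.inj hx
    exact ⟨app r t, P.D_extend r t hr, app_app [a] r t⟩

/-- External and internal choice, which coincide in this model. -/
def choice (P Q : Proc E) : Proc E where
  T := P.T ∪ Q.T
  D := P.D ∪ Q.D
  D_subset := Set.union_subset_union P.D_subset Q.D_subset
  D_of_tick := fun s h => h.imp (P.D_of_tick s) (Q.D_of_tick s)
  T_nonempty := ⟨Trace.nil, Or.inl P.nil_mem⟩
  T_prefix := fun s t hst h => h.imp (P.T_prefix s t hst) (Q.T_prefix s t hst)
  D_extend := fun s t h => h.imp (P.D_extend s t) (Q.D_extend s t)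

/-- The divergences of `P ; Q`. -/
def seqD (P Q : Proc E) : Set (Trace E) :=
  P.D ∪ {x | ∃ (t : List E) (s : Trace E), (⟨t, true⟩ : Trace E) ∈ P.T ∧ s ∈ Q.D ∧ x = app t s}

/-- `P ; Q`. -/
def seq (P Q : Proc E) : Proc E where
  T := {x | x ∈ P.T ∧ x.tick = false} ∪
    {x | ∃ (t : List E) (s : Trace E), (⟨t, true⟩ : Trace E) ∈ P.T ∧ s ∈ Q.T ∧ x = app t s} ∪
    seqD P Q
  D := seqD P Q
  D_subset := Set.subset_union_right
  D_of_tick := by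
    rintro s (h | ⟨t, ⟨r, b⟩, ht, hr, hx⟩)
    · exact Or.inl (P.D_of_tick s h)
    · obtain ⟨rfl, rfl⟩ := Trace.mk.inj hx
      exact Or.inr ⟨t, ⟨r, false⟩, ht, Q.D_of_tick r hr, rfl⟩
  T_nonempty := ⟨Trace.nil, Or.inl (Or.inl ⟨P.nil_mem, rfl⟩)⟩
  T_prefix := by
    have key : ∀ (x : Trace E) (t : List E) (s : Trace E), (⟨t, true⟩ : Trace E) ∈ P.T →
        s ∈ Q.T → x.IsPrefix (app t s) → (x ∈ P.T ∧ x.tick = false) ∨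
        ∃ (t : List E) (s : Trace E), (⟨t, true⟩ : Trace E) ∈ P.T ∧ s ∈ Q.T ∧ x = app t s := by
      intro x t s ht hs hx
      rcases isPrefix_app hx with ⟨h1, h2⟩ | ⟨r, rfl, hr⟩
      · exact Or.inl ⟨P.T_prefix x ⟨t, true⟩ (Or.inr ⟨h1, h2⟩) ht, h1⟩
      · exact Or.inr ⟨t, r, ht, Q.T_prefix _ _ hr hs, rfl⟩
    rintro x y hxy ((⟨h1, h2⟩ | ⟨t, s, ht, hs, rfl⟩) | h | ⟨t, s, ht, hs, rfl⟩)
    · refine Or.inl (Or.inl ⟨P.T_prefix x y hxy h1, ?_⟩)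
      rcases hxy with rfl | h
      exacts [h2, h.1]
    · exact Or.inl (key x t s ht hs hxy)
    · rcases hxy with rfl | hxy
      · exact Or.inr (Or.inl h)
      · exact Or.inl (Or.inl ⟨P.T_prefix x y (Or.inr hxy) (P.D_subset h), hxy.1⟩)
    · exact Or.inl (key x t s ht (Q.D_subset hs) hxy)
  D_extend := by
    rintro s t (h | ⟨r, ⟨q, b⟩, hr, hq, hx⟩)
    · exact Or.inl (P.D_extend s t h)
    · obtain ⟨rfl, rfl⟩ := Trace.mk.inj hx
      exact Or.inr ⟨r, app q t, hr, Q.D_extend q t hq, app_app r q t⟩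

/-- If `T₀` is nonempty and prefix-closed and the divergences are the
extensions of a set `B` of sequences lying in `T₀`, then the pair
`(T₀ ∪ B ⌢ Σ^{*✓}, B ⌢ Σ^{*✓})` satisfies the axioms. -/
def ofBase (T₀ : Set (Trace E)) (B : Set (List E)) (h₀ : T₀.Nonempty)
    (hpre : ∀ s t : Trace E, s.IsPrefix t → t ∈ T₀ → s ∈ T₀)
    (hB : ∀ s ∈ B, (⟨s, false⟩ : Trace E) ∈ T₀) : Proc E where
  T := T₀ ∪ {x | ∃ s ∈ B, ∃ r : Trace E, x = app s r}
  D := {x | ∃ s ∈ B, ∃ r : Trace E, x = app s r}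
  D_subset := Set.subset_union_right
  D_of_tick := by
    rintro s ⟨t, ht, ⟨r, b⟩, hx⟩
    obtain ⟨rfl, rfl⟩ := Trace.mk.inj hx
    exact ⟨t, ht, ⟨r, false⟩, rfl⟩
  T_nonempty := h₀.mono Set.subset_union_left
  T_prefix := by
    rintro x y hxy (h | ⟨s, hs, r, rfl⟩)
    · exact Or.inl (hpre x y hxy h)
    · rcases isPrefix_app hxy with h | ⟨r', rfl, -⟩
      · exact Or.inl (hpre x ⟨s, false⟩ (Or.inr h) (hB s hs))
      · exact Or.inr ⟨s, hs, r', rfl⟩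
  D_extend := by
    rintro s t ⟨r, hr, ⟨q, b⟩, hx⟩
    obtain ⟨rfl, rfl⟩ := Trace.mk.inj hx
    exact ⟨r, hr, app q t, app_app r q t⟩

theorem ofBase_mono {T₀ T₁ : Set (Trace E)} {B₀ B₁ : Set (List E)} {h₀ p₀ b₀ h₁ p₁ b₁}
    (hT : T₁ ⊆ T₀) (hB : B₁ ⊆ B₀) : ofBase T₀ B₀ h₀ p₀ b₀ ≤ ofBase T₁ B₁ h₁ p₁ b₁ :=
  have h : {x | ∃ s ∈ B₁, ∃ r : Trace E, x = app s r} ⊆ {x | ∃ s ∈ B₀, ∃ r : Trace E, x = app s r} :=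
    fun _ ⟨s, hs, r, hr⟩ => ⟨s, hB hs, r, hr⟩
  ⟨Set.union_subset_union hT h, h⟩

/-- `P \ A`.  The divergences are the extensions of `t ↾ (Σ \ A)` where either `t` is a divergence
of `P`, or `t` is an initial segment of an infinite trace of `P` all of whose events after `t`
lie in `A` (so that `t ↾ (Σ \ A)` is the finite restriction of the whole infinite trace). -/
noncomputable def hide (A : Set E) (P : Proc E) : Proc E :=
  ofBase {x | ∃ t ∈ P.T, x = ⟨hideList A t.events, t.tick⟩}
    ({s | ∃ t : List E, (⟨t, false⟩ : Trace E) ∈ P.D ∧ s = hideList A t} ∪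
      {s | ∃ u : ℕ → E, u ∈ P.infTraces ∧
        ∃ N, (∀ n, N ≤ n → u n ∈ A) ∧ s = hideList A (initSeg u N)})
    ⟨_, Trace.nil, P.nil_mem, rfl⟩
    (by
      rintro x y hxy ⟨t, ht, rfl⟩
      rcases hxy with rfl | ⟨h1, h2⟩
      · exact ⟨t, ht, rfl⟩
      · obtain ⟨s, hs, hx⟩ := hideList_prefix h2
        exact ⟨⟨s, false⟩, P.T_prefix _ t (Or.inr ⟨rfl, hs⟩) ht, Trace.ext hx h1⟩)
    (by
      rintro s (⟨t, ht, rfl⟩ | ⟨u, hu, N, -, rfl⟩)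
      · exact ⟨_, P.D_subset ht, rfl⟩
      · exact ⟨_, hu N, rfl⟩)

/-- `P[R]`, where the lifting of `R` to traces is element-wise and relates `✓` to itself only. -/
def rename (R : E → E → Prop) (P : Proc E) : Proc E :=
  ofBase {x | ∃ s ∈ P.T, List.Forall₂ R s.events x.events ∧ s.tick = x.tick}
    {t | ∃ s : List E, (⟨s, false⟩ : Trace E) ∈ P.D ∧ List.Forall₂ R s t}
    ⟨Trace.nil, Trace.nil, P.nil_mem, .nil, rfl⟩
    (by
      rintro x y hxy ⟨t, ht, hty, htick⟩
      rcases hxy with rfl | ⟨h1, h2⟩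
      · exact ⟨t, ht, hty, htick⟩
      · obtain ⟨s, hs, hx⟩ := forall₂_prefix hty h2
        exact ⟨⟨s, false⟩, P.T_prefix _ t (Or.inr ⟨rfl, hs⟩) ht, hx, h1.symm⟩)
    (by
      rintro t ⟨s, hs, h⟩
      exact ⟨_, P.D_subset hs, h, rfl⟩)

/-- `P ∥_A Q`. -/
def par (A : Set E) (P Q : Proc E) : Proc E :=
  ofBase {u | ∃ s ∈ P.T, ∃ t ∈ Q.T, Par A s t u}
    {u | ∃ s ∈ P.T, ∃ t ∈ Q.T, Par A s t ⟨u, false⟩ ∧ (s ∈ P.D ∨ t ∈ Q.D)}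
    ⟨Trace.nil, Trace.nil, P.nil_mem, Trace.nil, Q.nil_mem, .nil, rfl, rfl⟩
    (by
      rintro x y hxy ⟨s, hs, t, ht, h⟩
      rcases hxy with rfl | ⟨h1, h2⟩
      · exact ⟨s, hs, t, ht, h⟩
      · obtain ⟨s', t', hs', ht', hi⟩ := h.1.prefix _ h2
        exact ⟨⟨s', false⟩, P.T_prefix _ s (Or.inr ⟨rfl, hs'⟩) hs,
          ⟨t', false⟩, Q.T_prefix _ t (Or.inr ⟨rfl, ht'⟩) ht, hi, h1.symm, h1.symm⟩)
    (by
      rintro u ⟨s, hs, t, ht, h, -⟩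
      exact ⟨s, hs, t, ht, h⟩)

/-! All operators are monotone. -/

theorem infTraces_mono {P Q : Proc E} (h : P ≤ Q) : Q.infTraces ⊆ P.infTraces :=
  fun _ hu n => h.1 (hu n)

theorem pre_mono {a : E} {P Q : Proc E} (h : P ≤ Q) : pre a P ≤ pre a Q :=
  ⟨Set.union_subset_union_right _ fun _ ⟨t, ht, hx⟩ => ⟨t, h.1 ht, hx⟩,
    fun _ ⟨t, ht, hx⟩ => ⟨t, h.2 ht, hx⟩⟩

theorem choice_mono {P P' Q Q' : Proc E} (h : P ≤ P') (k : Q ≤ Q') :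
    choice P Q ≤ choice P' Q' :=
  ⟨Set.union_subset_union h.1 k.1, Set.union_subset_union h.2 k.2⟩

theorem seq_mono {P P' Q Q' : Proc E} (h : P ≤ P') (k : Q ≤ Q') : seq P Q ≤ seq P' Q' := by
  have hD : seqD P' Q' ⊆ seqD P Q :=
    Set.union_subset_union h.2 fun _ ⟨t, s, ht, hs, hx⟩ => ⟨t, s, h.1 ht, k.2 hs, hx⟩
  exact ⟨Set.union_subset_union (Set.union_subset_union (fun _ hx => ⟨h.1 hx.1, hx.2⟩)
    fun _ ⟨t, s, ht, hs, hx⟩ => ⟨t, s, h.1 ht, k.1 hs, hx⟩) hD, hD⟩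

theorem hide_mono {A : Set E} {P Q : Proc E} (h : P ≤ Q) : hide A P ≤ hide A Q :=
  ofBase_mono (fun _ ⟨t, ht, hx⟩ => ⟨t, h.1 ht, hx⟩)
    (Set.union_subset_union (fun _ ⟨t, ht, hx⟩ => ⟨t, h.2 ht, hx⟩)
      fun _ ⟨u, hu, hx⟩ => ⟨u, infTraces_mono h hu, hx⟩)

theorem rename_mono {R : E → E → Prop} {P Q : Proc E} (h : P ≤ Q) : rename R P ≤ rename R Q :=
  ofBase_mono (fun _ ⟨s, hs, hx⟩ => ⟨s, h.1 hs, hx⟩) (fun _ ⟨s, hs, hx⟩ => ⟨s, h.2 hs, hx⟩)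

theorem par_mono {A : Set E} {P P' Q Q' : Proc E} (h : P ≤ P') (k : Q ≤ Q') :
    par A P Q ≤ par A P' Q' :=
  ofBase_mono (fun _ ⟨s, hs, t, ht, hx⟩ => ⟨s, h.1 hs, t, k.1 ht, hx⟩)
    (fun _ ⟨s, hs, t, ht, hx, hd⟩ => ⟨s, h.1 hs, t, k.1 ht, hx, hd.imp (@h.2 _) (@k.2 _)⟩)

end Proc

/-! ### Terms -/

/-- CSP terms with events in `E` and process variables in `X`. -/
inductive Term (E X : Type*) where
  | STOP : Term E X
  | pre (a : E) (P : Term E X) : Term E X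
  | SKIP : Term E X
  | intChoice (P Q : Term E X) : Term E X
  | extChoice (P Q : Term E X) : Term E X
  | par (A : Set E) (P Q : Term E X) : Term E X
  | seq (P Q : Term E X) : Term E X
  | hide (P : Term E X) (A : Set E) : Term E X
  | rename (P : Term E X) (R : E → E → Prop) : Term E X
  | var (x : X) : Term E X
  | mu (x : X) (P : Term E X) : Term E X
  | DIV : Term E X

namespace Term

variable {E X : Type*}

/-- The set of free variables; `mu x` binds `x`. -/
def freeVars : Term E X → Set X
  | STOP => ∅
  | pre _ P => P.freeVars
  | SKIP => ∅
  | intChoice P Q => P.freeVars ∪ Q.freeVars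
  | extChoice P Q => P.freeVars ∪ Q.freeVars
  | par _ P Q => P.freeVars ∪ Q.freeVars
  | seq P Q => P.freeVars ∪ Q.freeVars
  | hide P _ => P.freeVars
  | rename P _ => P.freeVars
  | var x => {x}
  | mu x P => P.freeVars \ {x}
  | DIV => ∅

/-- A term is closed if it has no free variables, and open otherwise. -/
def IsClosed (P : Term E X) : Prop := P.freeVars = ∅

/-- The interpretation of a term as a monotone function of the processes assigned to its
variables; recursion is interpreted by the least fixed point. -/
noncomputable def denote [DecidableEq X] : Term E X → ((X → Proc E) →o Proc E)
  | STOP => ⟨fun _ => Proc.STOP, fun _ _ _ => le_rfl⟩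
  | pre a P => ⟨fun ρ => Proc.pre a (P.denote ρ), fun _ _ h => Proc.pre_mono (P.denote.mono h)⟩
  | SKIP => ⟨fun _ => Proc.SKIP, fun _ _ _ => le_rfl⟩
  | intChoice P Q => ⟨fun ρ => Proc.choice (P.denote ρ) (Q.denote ρ),
      fun _ _ h => Proc.choice_mono (P.denote.mono h) (Q.denote.mono h)⟩
  | extChoice P Q => ⟨fun ρ => Proc.choice (P.denote ρ) (Q.denote ρ),
      fun _ _ h => Proc.choice_mono (P.denote.mono h) (Q.denote.mono h)⟩
  | par A P Q => ⟨fun ρ => Proc.par A (P.denote ρ) (Q.denote ρ),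
      fun _ _ h => Proc.par_mono (P.denote.mono h) (Q.denote.mono h)⟩
  | seq P Q => ⟨fun ρ => Proc.seq (P.denote ρ) (Q.denote ρ),
      fun _ _ h => Proc.seq_mono (P.denote.mono h) (Q.denote.mono h)⟩
  | hide P A => ⟨fun ρ => Proc.hide A (P.denote ρ),
      fun _ _ h => Proc.hide_mono (P.denote.mono h)⟩
  | rename P R => ⟨fun ρ => Proc.rename R (P.denote ρ),
      fun _ _ h => Proc.rename_mono (P.denote.mono h)⟩
  | var x => ⟨fun ρ => ρ x, fun _ _ h => h x⟩
  | mu x P =>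
    { toFun := fun ρ => OrderHom.lfp
        ⟨fun ξ => P.denote (Function.update ρ x ξ),
          fun _ _ h => P.denote.mono (Function.update_mono h)⟩
      monotone' := fun _ _ h => OrderHom.lfp.mono fun _ =>
        P.denote.mono (update_le_update_iff.mpr ⟨le_rfl, fun y _ => h y⟩) }
  | DIV => ⟨fun _ => Proc.DIV, fun _ _ _ => le_rfl⟩

/-- `P(θ₁, …, θₙ)`: the interpretation of `P` when the variable `x i` is assigned `θ i`.  For
distinct `x i` that include all free variables of `P`, the assignment of `⊥` to all remaining
variables is irrelevant. -/
noncomputable def subst [DecidableEq X] (P : Term E X) {n : ℕ} (x : Fin n → X)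
    (θ : Fin n → Proc E) : Proc E :=
  P.denote (Function.extend x θ fun _ => ⊥)

/-! ### The static analysis -/

/-- The image `R(U)`. -/
def image (R : E → E → Prop) (U : Set E) : Set E := {y | ∃ x ∈ U, R x y}

/-- The set `S` if `x` is free in `P`, and the set of all pairs otherwise. -/
def ifFree (x : X) (P : Term E X) (S : Set (Set E × Set E)) : Set (Set E × Set E) :=
  {p | x ∈ P.freeVars → p ∈ S}

/-- Nonexpansive sets. -/
def N (x : X) : Term E X → Set (Set E × Set E)
  | STOP => Set.univ
  | SKIP => Set.univ
  | DIV => Set.univ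
  | pre a P => ifFree x (pre a P) (N x P)
  | intChoice P Q => ifFree x (intChoice P Q) (N x P ∩ N x Q)
  | extChoice P Q => ifFree x (extChoice P Q) (N x P ∩ N x Q)
  | seq P Q => ifFree x (seq P Q) (N x P ∩ N x Q)
  | par A P Q => ifFree x (par A P Q) (N x P ∩ N x Q)
  | hide P A => ifFree x (hide P A)
      {(U, V) | ∃ V', (U, V') ∈ N x P ∧ V' ∩ A = ∅ ∧ V' ⊆ V}
  | rename P R => ifFree x (rename P R) {(U, V) | ∃ V', (U, V') ∈ N x P ∧ image R V' ⊆ V}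
  | var y => ifFree x (var y) {p | p.1 ⊆ p.2}
  | mu y P => ifFree x (mu y P)
      {(U, V) | ∃ U' V', (U', V') ∈ N x P ∧ (V', V') ∈ N y P ∧ U ⊆ U' ∧ V' ⊆ V}

mutual

/-- Guard sets.  Divergence may be followed by `✓`, so that `DIV` has no guard set. -/
noncomputable def G : Term E X → Set (Set E)
  | STOP => Set.univ
  | pre a P => G P ∪ {V | a ∈ V}
  | SKIP => ∅
  | intChoice P Q => G P ∩ G Q
  | extChoice P Q => G P ∩ G Q
  | seq P Q => open Classical in
      if P.IsClosed ∧ F P ≠ ∅ then G P ∪ G Q else G P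
  | par _ P Q => open Classical in
      if (P.IsClosed ∧ F P ≠ ∅) ∧ (Q.IsClosed ∧ F Q ≠ ∅) then G P ∪ G Q else G P ∩ G Q
  | hide P A => open Classical in
      if P.IsClosed ∧ (∅, Aᶜ) ∈ F P then {V | ∃ V' ∈ G P, V' ∩ A = ∅ ∧ V' ⊆ V} else ∅
  | rename P R => {V | ∃ V' ∈ G P, image R V' ⊆ V}
  | var _ => ∅
  | mu _ P => G P
  | DIV => ∅

/-- Contractive sets. -/
noncomputable def C : Term E X → X → Set (Set E × Set E)
  | STOP, _ => Set.univ
  | SKIP, _ => Set.univ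
  | DIV, _ => Set.univ
  | pre a P, x => ifFree x (pre a P) (C P x ∪ {(U, V) | (U, V) ∈ N x P ∧ a ∈ V})
  | intChoice P Q, x => ifFree x (intChoice P Q) (C P x ∩ C Q x)
  | extChoice P Q, x => ifFree x (extChoice P Q) (C P x ∩ C Q x)
  | par A P Q, x => ifFree x (par A P Q) (C P x ∩ C Q x)
  | seq P Q, x => ifFree x (seq P Q)
      (C P x ∩ (C Q x ∪ {(U, V) | (U, V) ∈ N x Q ∧ V ∈ G P}))
  | hide P A, x => ifFree x (hide P A)
      {(U, V) | ∃ V', (U, V') ∈ C P x ∧ V' ∩ A = ∅ ∧ V' ⊆ V}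
  | rename P R, x => ifFree x (rename P R) {(U, V) | ∃ V', (U, V') ∈ C P x ∧ image R V' ⊆ V}
  | var y, x => ifFree x (var y) ∅
  | mu y P, x => ifFree x (mu y P)
      {(U, V) | ∃ U' V', (U', V') ∈ C P x ∧ (V', V') ∈ N y P ∧ U ⊆ U' ∧ V' ⊆ V}

/-- Fair sets.  The term `DIV` is not livelock-free and has no fair pair. -/
noncomputable def F : Term E X → Set (Set E × Set E)
  | STOP => Set.univ
  | pre _ P => F P
  | SKIP => Set.univ
  | intChoice P Q => F P ∩ F Q
  | extChoice P Q => F P ∩ F Q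
  | seq P Q => F P ∩ F Q
  | par A P Q => (F P ∩ F Q) ∪
      {(U, V) | ∃ U₁ U₂, U = U₁ ∩ U₂ ∧ (U₁, V) ∈ F P ∧ (U₂, A) ∈ F Q} ∪
      {(U, V) | ∃ U₁ U₂, U = U₁ ∩ U₂ ∧ (U₂, V) ∈ F Q ∧ (U₁, A) ∈ F P}
  | hide P A => {(U, V) | ∃ V', (U, V') ∈ F P ∧ V' ∩ A = ∅ ∧ V' ⊆ V}
  | rename P R => {(U, V) | ∃ V', (U, V') ∈ F P ∧ image R V' ⊆ V}
  | var _ => {p | p.1 ⊆ p.2}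
  | mu x P => open Classical in
      if (mu x P).IsClosed then {(_U, V) | ∃ W, (W, W) ∈ C P x ∩ F P ∧ W ⊆ V}
      else {(U, V) | ∃ W, (W, W) ∈ C P x ∩ F P ∧ U ⊆ W ∧ W ⊆ V}
  | DIV => ∅

end

end Term

end CSP

-- Measure the agreement of two processes by the number of events of a set `V` up to which they have
-- the same traces and divergences; `Approx V n` is one half of such agreement. On this scale a pair
-- in `N` makes the term nonexpansive in a variable and a pair in `C` makes it contractive, with a
-- gain of one event (`Modulus` with `d = 0` and `d = 1`). A set in `G` must be visited before
-- termination (`Guarded`), and this supplies the gain for the second component of a sequential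
-- composition.
--
-- Fairness and livelock-freedom are replaced by `UniformlyFair`, which bounds the length of a trace
-- in terms of its number of events of `V`. Over a finite alphabet the two are equivalent by König's
-- lemma, needed only for the processes substituted for the variables. The uniform form passes
-- through the operators by counting events.
--
-- The decisive case is recursion, `UniformlyFair.of_contractive`. The bottom process diverges, so
-- iteration towards the least fixed point from below gives no fair approximants. Iteration from
-- `STOP` does: all iterates are uniformly fair, and by contractivity the `n`-th one contains every
-- trace and divergence of the fixed point with fewer than `n` events of `W`. A divergence, or the
-- traces subject to one length bound, involve boundedly many events of `W`, so a single iterate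
-- decides each requirement.
--
-- Nonexpansiveness is a separate induction (`modulus_of_mem_N`). The other three analyses are
-- proved together (`sound`): `C` uses `G`, `F` uses `C`, and `G` uses `F` to exclude divergences,
-- after which `✓` could occur unguarded.

namespace CSP

-- Counting events of a set in finite and infinite sequences.

namespace Trace

variable {E : Type*}

/-- The number of occurrences of events of `V`. -/
noncomputable def count (V : Set E) (s : List E) : ℕ :=
  open Classical in s.countP (fun a => decide (a ∈ V))

theorem count_nil (V : Set E) : count V [] = 0 := rfl

theorem count_cons_mem {V : Set E} {a : E} (h : a ∈ V) (s : List E) :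
    count V (a :: s) = count V s + 1 := by
  simp [count, h]

theorem count_cons_notMem {V : Set E} {a : E} (h : a ∉ V) (s : List E) :
    count V (a :: s) = count V s := by
  simp [count, h]

theorem count_append (V : Set E) (s t : List E) :
    count V (s ++ t) = count V s + count V t := by
  simp [count]

theorem count_le_cons (V : Set E) (a : E) (s : List E) : count V s ≤ count V (a :: s) := by
  by_cases h : a ∈ V
  · rw [count_cons_mem h]; omega
  · rw [count_cons_notMem h]

theorem count_mono {V W : Set E} (h : V ⊆ W) (s : List E) : count V s ≤ count W s := by
  classical
  exact List.countP_mono_left fun a _ ha => by simpa using h (by simpa using ha)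

theorem count_le_of_prefix {V : Set E} {s t : List E} (h : s <+: t) : count V s ≤ count V t := by
  obtain ⟨r, rfl⟩ := h
  rw [count_append]; omega

theorem count_hideList {A V : Set E} (h : V ∩ A = ∅) (s : List E) :
    count V (hideList A s) = count V s := by
  classical
  induction s with
  | nil => rfl
  | cons a s ih =>
    by_cases ha : a ∈ A
    · have hV : a ∉ V := fun hV => (h ▸ (⟨hV, ha⟩ : a ∈ V ∩ A) : a ∈ (∅ : Set E))
      rw [count_cons_notMem hV, ← ih]
      simp [hideList, ha]
    · have : hideList A (a :: s) = a :: hideList A s := by simp [hideList, ha]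
      rw [this]
      by_cases hV : a ∈ V
      · rw [count_cons_mem hV, count_cons_mem hV, ih]
      · rw [count_cons_notMem hV, count_cons_notMem hV, ih]

theorem hideList_length_le (A : Set E) (s : List E) : (hideList A s).length ≤ s.length := by
  classical
  exact List.length_filter_le _ _

theorem count_le_of_forall₂ {R : E → E → Prop} {V W : Set E}
    (h : Term.image R V ⊆ W) {s t : List E} (hst : List.Forall₂ R s t) :
    count V s ≤ count W t := by
  induction hst with
  | nil => exact le_rfl
  | @cons a b s t hab _ ih =>
    by_cases ha : a ∈ V
    · rw [count_cons_mem ha, count_cons_mem (h ⟨a, ha, hab⟩)]; omega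
    · rw [count_cons_notMem ha]
      exact ih.trans (count_le_cons _ _ _)

theorem Interleave.symm {A : Set E} {s t u : List E} (h : Interleave A s t u) :
    Interleave A t s u := by
  induction h with
  | nil => exact .nil
  | sync ha _ ih => exact .sync ha ih
  | left hb _ ih => exact .right hb ih
  | right hb _ ih => exact .left hb ih

theorem Interleave.sublist_left {A : Set E} {s t u : List E} (h : Interleave A s t u) :
    s.Sublist u := by
  induction h with
  | nil => exact .slnil
  | sync ha _ ih => exact ih.cons_cons _
  | left hb _ ih => exact ih.cons_cons _
  | right hb _ ih => exact ih.cons _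

theorem Interleave.count_left_le {A : Set E} {s t u : List E} (h : Interleave A s t u)
    (V : Set E) : count V s ≤ count V u := by
  classical
  exact h.sublist_left.countP_le

theorem Interleave.count_right_le {A : Set E} {s t u : List E} (h : Interleave A s t u)
    (V : Set E) : count V t ≤ count V u :=
  h.symm.count_left_le V

theorem Interleave.length_le {A : Set E} {s t u : List E} (h : Interleave A s t u) :
    u.length ≤ s.length + t.length := by
  induction h <;> grind

/-- Each event of `A` in `t` is matched with an event of `s` of its own. This lets a bound on one
component control the other. -/
theorem Interleave.count_sync_le {A : Set E} {s t u : List E} (h : Interleave A s t u) :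
    count A t ≤ s.length := by
  induction h with
  | nil => exact le_rfl
  | sync ha _ ih => rw [count_cons_mem ha]; simpa using ih
  | left hb _ ih => simp only [List.length_cons]; omega
  | right hb _ ih => rwa [count_cons_notMem hb]

theorem initSeg_succ (u : ℕ → E) (n : ℕ) : initSeg u (n + 1) = initSeg u n ++ [u n] := by
  simp [initSeg, List.range_succ]

theorem initSeg_length (u : ℕ → E) (n : ℕ) : (initSeg u n).length = n := by
  simp [initSeg]

theorem count_initSeg_mono (V : Set E) (u : ℕ → E) : Monotone fun n => count V (initSeg u n) :=
  monotone_nat_of_le_succ fun n => by rw [initSeg_succ, count_append]; omega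

/-- An infinite sequence with finitely many events of `V` has initial segments with boundedly
many events of `V`. -/
theorem exists_count_initSeg_le {V : Set E} {u : ℕ → E} (h : {n | u n ∈ V}.Finite) :
    ∃ k, ∀ n, count V (initSeg u n) ≤ k := by
  obtain ⟨N, hN⟩ := h.bddAbove
  refine ⟨count V (initSeg u (N + 1)), fun n => ?_⟩
  induction n with
  | zero => exact Nat.zero_le _
  | succ n ih =>
    rcases Nat.lt_or_ge N n with hn | hn
    · have hu : u n ∉ V := fun hu => absurd (hN hu) (by omega)
      rw [initSeg_succ, count_append, count_cons_notMem hu, count_nil]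
      exact ih
    · exact count_initSeg_mono V u (by omega)

/-- An infinite sequence whose initial segments have boundedly many events of `V` has
finitely many events of `V`. -/
theorem finite_of_count_initSeg_le {V : Set E} {u : ℕ → E} {k : ℕ}
    (h : ∀ n, count V (initSeg u n) ≤ k) : {n | u n ∈ V}.Finite := by
  by_contra hinf
  have key : ∀ m, ∃ n, m ≤ count V (initSeg u n) := by
    intro m
    induction m with
    | zero => exact ⟨0, Nat.zero_le _⟩
    | succ m ih =>
      obtain ⟨n, hn⟩ := ih
      obtain ⟨n', hn', hlt⟩ := Set.Infinite.exists_gt hinf n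
      refine ⟨n' + 1, ?_⟩
      rw [initSeg_succ, count_append, count_cons_mem (show u n' ∈ V from hn'), count_nil]
      have := count_initSeg_mono V u hlt.le
      simp only at this
      omega
  obtain ⟨n, hn⟩ := key (k + 1)
  have := h n
  omega

/-- **König's lemma** for prefix-closed sets of sequences over a finite alphabet. -/
theorem exists_initSeg_mem [Finite E] {S : Set (List E)}
    (hpre : ∀ s t, s <+: t → t ∈ S → s ∈ S) (hlen : ∀ M, ∃ s ∈ S, M < s.length) :
    ∃ u : ℕ → E, ∀ n, initSeg u n ∈ S := by
  classical
  -- The invariant of the construction: among the finitely many one-letter continuations of `s`, one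
  -- must again have extensions of unbounded length.
  let Q : List E → Prop := fun s => ∀ M, ∃ t ∈ S, M < t.length ∧ s <+: t
  have hstep : ∀ s, Q s → ∃ a, Q (s ++ [a]) := by
    intro s hs
    by_contra! hno
    simp only [Q] at hno
    push Not at hno
    choose M hM using hno
    obtain ⟨B, hB⟩ := (Set.finite_range M).bddAbove
    -- `B` dominates the bounds `M a` of all continuations; `s.length` forces the extension to be
    -- proper, so that it has a next letter.
    obtain ⟨t, ht, hlt, r, rfl⟩ := hs (max B s.length)
    cases r with
    | nil => simp at hlt
    | cons a r =>
      refine hM a (s ++ a :: r) ht ?_ ⟨r, by simp⟩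
      exact lt_of_le_of_lt (hB ⟨a, rfl⟩) (lt_of_le_of_lt (le_max_left _ _) hlt)
  have hnil : Q [] := fun M => by
    obtain ⟨t, ht, h⟩ := hlen M
    exact ⟨t, ht, h, List.nil_prefix⟩
  choose next hnext using hstep
  let seg : ℕ → {s // Q s} := fun n =>
    Nat.rec ⟨[], hnil⟩ (fun _ s => ⟨s.1 ++ [next s.1 s.2], hnext s.1 s.2⟩) n
  refine ⟨fun n => next (seg n).1 (seg n).2, fun n => ?_⟩
  have hseg : ∀ n, initSeg (fun n => next (seg n).1 (seg n).2) n = (seg n).1 := by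
    intro n
    induction n with
    | zero => rfl
    | succ n ih => rw [initSeg_succ, ih]
  rw [hseg]
  obtain ⟨t, ht, -, h⟩ := (seg n).2 0
  exact hpre _ _ h ht

end Trace

-- Approximation of processes up to a number of events.

namespace Proc

open Trace

variable {E : Type*}

/-- Every trace and every divergence of `P` with fewer than `n` events of `V` is one of `Q`. -/
def Approx (V : Set E) (n : ℕ) (P Q : Proc E) : Prop :=
  ∀ s : Trace E, count V s.events < n → (s ∈ P.T → s ∈ Q.T) ∧ (s ∈ P.D → s ∈ Q.D)

namespace Approx

variable {U V W A : Set E} {m n : ℕ} {P P' Q Q' : Proc E}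

theorem refl (V : Set E) (n : ℕ) (P : Proc E) : Approx V n P P := fun _ _ => ⟨id, id⟩

theorem trans (h : Approx V n P Q) (k : Approx V n Q Q') : Approx V n P Q' :=
  fun s hs => ⟨fun ht => (k s hs).1 ((h s hs).1 ht), fun hd => (k s hs).2 ((h s hs).2 hd)⟩

theorem zero (V : Set E) (P Q : Proc E) : Approx V 0 P Q :=
  fun _ h => absurd h (Nat.not_lt_zero _)

theorem mono_set (h : Approx V n P Q) (hVW : V ⊆ W) : Approx W n P Q :=
  fun s hs => h s ((count_mono hVW _).trans_lt hs)

theorem mono_nat (h : Approx V n P Q) (hmn : m ≤ n) : Approx V m P Q :=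
  fun s hs => h s (hs.trans_le hmn)

theorem sSup {S : Set (Proc E)} (h : ∀ Q ∈ S, Approx V n P Q) : Approx V n P (sSup S) :=
  fun s hs => ⟨fun ht Q hQ => (h Q hQ s hs).1 ht, fun hd Q hQ => (h Q hQ s hs).2 hd⟩

theorem pre (a : E) (h : Approx V n P P') : Approx V n (pre a P) (pre a P') := by
  intro s hs
  constructor
  · rintro (rfl | ⟨t, ht, rfl⟩)
    · exact Or.inl rfl
    · exact Or.inr ⟨t, (h t ((count_le_cons V a _).trans_lt hs)).1 ht, rfl⟩
  · rintro ⟨t, ht, rfl⟩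
    exact ⟨t, (h t ((count_le_cons V a _).trans_lt hs)).2 ht, rfl⟩

theorem pre_succ {a : E} (ha : a ∈ V) (h : Approx V n P P') :
    Approx V (n + 1) (Proc.pre a P) (Proc.pre a P') := by
  have key : ∀ t : Trace E, count V (app [a] t).events < n + 1 → count V t.events < n := by
    intro t ht
    have : count V (app [a] t).events = count V t.events + 1 := count_cons_mem ha _
    omega
  intro s hs
  constructor
  · rintro (rfl | ⟨t, ht, rfl⟩)
    · exact Or.inl rfl
    · exact Or.inr ⟨t, (h t (key t hs)).1 ht, rfl⟩
  · rintro ⟨t, ht, rfl⟩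
    exact ⟨t, (h t (key t hs)).2 ht, rfl⟩

theorem choice (h : Approx V n P P') (k : Approx V n Q Q') :
    Approx V n (choice P Q) (choice P' Q') :=
  fun s hs => ⟨Or.imp (h s hs).1 (k s hs).1, Or.imp (h s hs).2 (k s hs).2⟩

/-- The events of `V` in `t` are already spent when `Q` starts, so `Q` need only be approximated up
to the remainder. The subtraction is harmless, since only `t` with fewer than `n` such events
matter. -/
theorem seq (h : Approx V n P P')
    (k : ∀ t : List E, (⟨t, true⟩ : Trace E) ∈ P.T → Approx V (n - count V t) Q Q') :
    Approx V n (seq P Q) (seq P' Q') := by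
  have key : ∀ (t : List E) (s : Trace E), count V (app t s).events < n →
      count V t < n ∧ count V s.events < n - count V t := by
    intro t s hs
    simp only [app, count_append] at hs
    omega
  have hD : ∀ s : Trace E, count V s.events < n → s ∈ seqD P Q → s ∈ seqD P' Q' := by
    rintro s hs (hd | ⟨t, r, ht, hr, rfl⟩)
    · exact Or.inl ((h s hs).2 hd)
    · obtain ⟨h1, h2⟩ := key t r hs
      exact Or.inr ⟨t, r, (h _ h1).1 ht, (k t ht r h2).2 hr, rfl⟩
  refine fun s hs => ⟨?_, hD s hs⟩
  rintro ((⟨h1, h2⟩ | ⟨t, r, ht, hr, rfl⟩) | hd)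
  · exact Or.inl (Or.inl ⟨(h s hs).1 h1, h2⟩)
  · obtain ⟨h1, h2⟩ := key t r hs
    exact Or.inl (Or.inr ⟨t, r, (h _ h1).1 ht, (k t ht r h2).1 hr, rfl⟩)
  · exact Or.inr (hD s hs hd)

theorem ofBase {T₀ T₁ : Set (Trace E)} {B₀ B₁ : Set (List E)} {h₀ p₀ b₀ h₁ p₁ b₁}
    (hT : ∀ s ∈ T₀, count V s.events < n → s ∈ T₁)
    (hB : ∀ s ∈ B₀, count V s < n → s ∈ B₁) :
    Approx V n (ofBase T₀ B₀ h₀ p₀ b₀) (ofBase T₁ B₁ h₁ p₁ b₁) := by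
  have hD : ∀ s : Trace E, count V s.events < n → (∃ t ∈ B₀, ∃ r : Trace E, s = app t r) →
      ∃ t ∈ B₁, ∃ r : Trace E, s = app t r := by
    rintro _ hs ⟨t, ht, r, rfl⟩
    exact ⟨t, hB t ht ((count_le_of_prefix (List.prefix_append _ _)).trans_lt hs), r, rfl⟩
  exact fun s hs => ⟨Or.imp (fun ht => hT s ht hs) (hD s hs), hD s hs⟩

theorem hide (h : Approx V n P P') (hA : V ∩ A = ∅) : Approx V n (hide A P) (hide A P') := by
  refine ofBase ?_ ?_
  · rintro _ ⟨t, ht, rfl⟩ hs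
    simp only [count_hideList hA] at hs
    exact ⟨t, (h t hs).1 ht, rfl⟩
  · rintro _ (⟨t, ht, rfl⟩ | ⟨u, hu, N, hN, rfl⟩) hs <;> rw [count_hideList hA] at hs
    · exact Or.inl ⟨t, (h _ hs).2 ht, rfl⟩
    -- After position `N` the sequence `u` stays in `A`, hence outside `V`, so no prefix has more
    -- events of `V` than `initSeg u N`. The whole infinite trace therefore transfers to `P'`.
    · refine Or.inr ⟨u, fun m => (h _ ?_).1 (hu m), N, hN, rfl⟩
      refine lt_of_le_of_lt ?_ hs
      simp only
      induction m with
      | zero => exact Nat.zero_le _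
      | succ m ih =>
        rcases Nat.lt_or_ge m N with hm | hm
        · exact count_initSeg_mono V u hm
        · have hV : u m ∉ V := fun hV =>
            (hA ▸ (⟨hV, hN m hm⟩ : u m ∈ V ∩ A) : u m ∈ (∅ : Set E))
          rw [initSeg_succ, count_append, count_cons_notMem hV, count_nil]
          exact ih

theorem rename {R : E → E → Prop} (h : Approx V n P P') (hR : Term.image R V ⊆ W) :
    Approx W n (rename R P) (rename R P') := by
  refine ofBase ?_ ?_
  · rintro x ⟨s, hs, hsx, htick⟩ hx
    exact ⟨s, (h s ((count_le_of_forall₂ hR hsx).trans_lt hx)).1 hs, hsx, htick⟩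
  · rintro x ⟨s, hs, hsx⟩ hx
    exact ⟨s, (h _ ((count_le_of_forall₂ hR hsx).trans_lt hx)).2 hs, hsx⟩

theorem par (A : Set E) (h : Approx V n P P') (k : Approx V n Q Q') :
    Approx V n (par A P Q) (par A P' Q') := by
  refine ofBase ?_ ?_
  · rintro u ⟨s, hs, t, ht, hst⟩ hu
    exact ⟨s, (h s ((hst.1.count_left_le V).trans_lt hu)).1 hs,
      t, (k t ((hst.1.count_right_le V).trans_lt hu)).1 ht, hst⟩
  · rintro u ⟨s, hs, t, ht, hst, hd⟩ hu
    have h1 := h s ((hst.1.count_left_le V).trans_lt hu)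
    have h2 := k t ((hst.1.count_right_le V).trans_lt hu)
    exact ⟨s, h1.1 hs, t, h2.1 ht, hst, hd.imp h1.2 h2.2⟩

/-- Comparison of the least fixed points of two functions, the first of which respects
approximation. -/
theorem lfp {f g : Proc E →o Proc E} (hf : ∀ P Q, Approx V n P Q → Approx V n (f P) (f Q))
    (hfg : ∀ P, Approx V n (f P) (g P)) : Approx V n (OrderHom.lfp f) (OrderHom.lfp g) := by
  -- Suprema are intersections, and a one-sided inclusion into each member of a family gives one
  -- into the intersection. This is why `Approx` is not symmetric.
  refine OrderHom.lfp_induction g (p := fun Q => Approx V n (OrderHom.lfp f) Q) ?_ ?_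
  · intro Q hQ _
    have := (hf _ _ hQ).trans (hfg Q)
    rwa [f.map_lfp] at this
  · exact fun S hS => sSup hS

end Approx

-- Uniform fairness and its preservation by the operators.

/-- Livelock-freedom together with fairness in a uniform form: the traces with boundedly many
events of `V` are of bounded length. -/
structure UniformlyFair (V : Set E) (P : Proc E) : Prop where
  D_eq : P.D = ∅
  bound : ∀ k, ∃ M, ∀ s ∈ P.T, count V s.events ≤ k → s.events.length ≤ M

namespace UniformlyFair

variable {U V W A : Set E} {P Q : Proc E}

theorem fair (h : UniformlyFair V P) : P.Fair V := by
  intro u hu hfin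
  obtain ⟨k, hk⟩ := exists_count_initSeg_le hfin
  obtain ⟨M, hM⟩ := h.bound k
  have := hM _ (hu (M + 1)) (hk (M + 1))
  rw [initSeg_length] at this
  omega

/-- If arbitrarily long traces had at most `k` events of `V`, König's lemma would produce an
infinite trace with at most `k` of them. -/
theorem of_fair [Finite E] (hD : P.LivelockFree) (h : P.Fair V) : UniformlyFair V P := by
  refine ⟨hD, fun k => ?_⟩
  by_contra! hno
  obtain ⟨u, hu⟩ := exists_initSeg_mem
    (S := {s | (⟨s, false⟩ : Trace E) ∈ P.T ∧ count V s ≤ k})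
    (fun s t hst ht => ⟨P.T_prefix _ ⟨t, false⟩ (Or.inr ⟨rfl, hst⟩) ht.1,
      (count_le_of_prefix hst).trans ht.2⟩)
    (fun M => by
      obtain ⟨s, hs, hc, hl⟩ := hno M
      refine ⟨s.events, ⟨P.T_prefix _ s ?_ hs, hc⟩, hl⟩
      exact Or.inr ⟨rfl, List.prefix_rfl⟩)
  exact h u (fun n => (hu n).1) (finite_of_count_initSeg_le fun n => (hu n).2)

theorem mono (h : UniformlyFair V P) (hVW : V ⊆ W) : UniformlyFair W P :=
  ⟨h.D_eq, fun k => (h.bound k).imp fun _ hM s hs hk => hM s hs ((count_mono hVW _).trans hk)⟩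

theorem notMem_D (h : UniformlyFair V P) (s : Trace E) : s ∉ P.D := by
  rw [h.D_eq]; exact fun h => h

theorem STOP (V : Set E) : UniformlyFair V STOP :=
  ⟨rfl, fun _ => ⟨0, by rintro _ rfl -; exact le_rfl⟩⟩

theorem SKIP (V : Set E) : UniformlyFair V SKIP :=
  ⟨rfl, fun _ => ⟨0, by rintro _ (rfl | rfl) - <;> exact le_rfl⟩⟩

theorem pre (a : E) (h : UniformlyFair V P) : UniformlyFair V (pre a P) := by
  refine ⟨Set.eq_empty_iff_forall_notMem.mpr fun _ ⟨t, ht, _⟩ => h.notMem_D t ht, fun k => ?_⟩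
  obtain ⟨M, hM⟩ := h.bound k
  refine ⟨M + 1, ?_⟩
  rintro _ (rfl | ⟨t, ht, rfl⟩) hk
  · exact Nat.zero_le _
  · have := hM t ht ((count_le_cons V a _).trans hk)
    simpa [app] using this

theorem choice (h : UniformlyFair V P) (k : UniformlyFair V Q) :
    UniformlyFair V (choice P Q) := by
  refine ⟨Set.union_empty_iff.mpr ⟨h.D_eq, k.D_eq⟩, fun n => ?_⟩
  obtain ⟨M, hM⟩ := h.bound n
  obtain ⟨M', hM'⟩ := k.bound n
  refine ⟨M + M', ?_⟩
  rintro s (hs | hs) hc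
  · exact (hM s hs hc).trans (by omega)
  · exact (hM' s hs hc).trans (by omega)

theorem seqD_eq (hP : P.D = ∅) (hQ : Q.D = ∅) : seqD P Q = ∅ := by
  refine Set.eq_empty_iff_forall_notMem.mpr ?_
  rintro s (hs | ⟨t, r, -, hr, -⟩)
  · simp [hP] at hs
  · simp [hQ] at hr

theorem seq (h : UniformlyFair V P) (k : UniformlyFair V Q) : UniformlyFair V (seq P Q) := by
  have hD := seqD_eq h.D_eq k.D_eq
  refine ⟨hD, fun n => ?_⟩
  obtain ⟨M, hM⟩ := h.bound n
  obtain ⟨M', hM'⟩ := k.bound n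
  refine ⟨M + M', ?_⟩
  rintro s ((hs | ⟨t, r, ht, hr, rfl⟩) | hs) hc
  · exact (hM s hs.1 hc).trans (by omega)
  · simp only [app, count_append, List.length_append] at hc ⊢
    have h1 := hM _ ht (by simp only; omega)
    have h2 := hM' r hr (by omega)
    simp only at h1
    omega
  · simp [hD] at hs

theorem ofBase {T₀ : Set (Trace E)} {B : Set (List E)} {h₀ p₀ b₀} (hB : B = ∅)
    (hT : ∀ k, ∃ M, ∀ s ∈ T₀, count V s.events ≤ k → s.events.length ≤ M) :
    UniformlyFair V (ofBase T₀ B h₀ p₀ b₀) := by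
  subst hB
  refine ⟨Set.eq_empty_iff_forall_notMem.mpr fun _ ⟨_, hs, _⟩ => hs, fun k => ?_⟩
  obtain ⟨M, hM⟩ := hT k
  exact ⟨M, fun s hs => hs.elim (hM s) fun ⟨_, hs, _⟩ => hs.elim⟩

theorem hide (h : UniformlyFair V P) (hA : V ∩ A = ∅) : UniformlyFair V (hide A P) := by
  refine ofBase (Set.eq_empty_iff_forall_notMem.mpr ?_) fun k => ?_
  · rintro s (⟨t, ht, -⟩ | ⟨u, hu, N, hN, -⟩)
    · exact h.notMem_D _ ht
    -- Hiding creates a divergence only from an infinite trace that ends inside `A`; its events of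
    -- `V` all lie before `N`, against fairness.
    · refine h.fair u hu ((Set.finite_lt_nat N).subset fun n hn => ?_)
      by_contra hNn
      exact (hA ▸ (⟨hn, hN n (not_lt.mp hNn)⟩ : u n ∈ V ∩ A) : u n ∈ (∅ : Set E))
  · obtain ⟨M, hM⟩ := h.bound k
    refine ⟨M, ?_⟩
    rintro _ ⟨t, ht, rfl⟩ hk
    simp only [count_hideList hA] at hk
    exact (hideList_length_le A _).trans (hM t ht hk)

theorem rename {R : E → E → Prop} (h : UniformlyFair V P) (hR : Term.image R V ⊆ W) :
    UniformlyFair W (rename R P) := by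
  refine ofBase (Set.eq_empty_iff_forall_notMem.mpr ?_) fun k => ?_
  · rintro s ⟨t, ht, -⟩
    exact h.notMem_D _ ht
  · obtain ⟨M, hM⟩ := h.bound k
    refine ⟨M, ?_⟩
    rintro x ⟨s, hs, hsx, -⟩ hk
    rw [← hsx.length_eq]
    exact hM s hs ((count_le_of_forall₂ hR hsx).trans hk)

theorem par (h : UniformlyFair V P) (k : UniformlyFair V Q) : UniformlyFair V (par A P Q) := by
  refine ofBase (Set.eq_empty_iff_forall_notMem.mpr ?_) fun n => ?_
  · rintro s ⟨s, -, t, -, -, hs | ht⟩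
    exacts [h.notMem_D _ hs, k.notMem_D _ ht]
  · obtain ⟨M, hM⟩ := h.bound n
    obtain ⟨M', hM'⟩ := k.bound n
    refine ⟨M + M', ?_⟩
    rintro u ⟨s, hs, t, ht, hst, -⟩ hu
    have h1 := hM s hs ((hst.count_left_le V).trans hu)
    have h2 := hM' t ht ((hst.count_right_le V).trans hu)
    have := hst.length_le
    omega

/-- Few events of `V` make the trace of `P` short. It then takes part in few synchronisations, so
the trace of `Q` has few events of `A` and is short as well. -/
theorem par_left (h : UniformlyFair V P) (k : UniformlyFair A Q) :
    UniformlyFair V (Proc.par A P Q) := by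
  refine ofBase (Set.eq_empty_iff_forall_notMem.mpr ?_) fun n => ?_
  · rintro s ⟨s, -, t, -, -, hs | ht⟩
    exacts [h.notMem_D _ hs, k.notMem_D _ ht]
  · obtain ⟨M, hM⟩ := h.bound n
    obtain ⟨M', hM'⟩ := k.bound M
    refine ⟨M + M', ?_⟩
    rintro u ⟨s, hs, t, ht, hst, -⟩ hu
    have h1 := hM s hs ((hst.count_left_le V).trans hu)
    have h2 := hM' t ht (hst.count_sync_le.trans h1)
    have := hst.length_le
    omega

theorem par_right (h : UniformlyFair A P) (k : UniformlyFair V Q) :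
    UniformlyFair V (Proc.par A P Q) := by
  refine ofBase (Set.eq_empty_iff_forall_notMem.mpr ?_) fun n => ?_
  · rintro s ⟨s, -, t, -, -, hs | ht⟩
    exacts [h.notMem_D _ hs, k.notMem_D _ ht]
  · obtain ⟨M, hM⟩ := k.bound n
    obtain ⟨M', hM'⟩ := h.bound M
    refine ⟨M + M', ?_⟩
    rintro u ⟨s, hs, t, ht, hst, -⟩ hu
    have h1 := hM t ht ((hst.count_right_le V).trans hu)
    have h2 := hM' s hs (hst.symm.count_sync_le.trans h1)
    have := hst.length_le
    omega

/-- A fixed point of a contractive function that preserves uniform fairness is uniformly fair. -/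
theorem of_contractive {f : Proc E → Proc E} (hP : f P = P)
    (hc : ∀ n P Q, Approx W n P Q → Approx W (n + 1) (f P) (f Q))
    (hf : ∀ P, UniformlyFair W P → UniformlyFair W (f P)) : UniformlyFair W P := by
  -- `Q` is the `n`-th iterate of `f` on `STOP`; at `n = 0` the approximation is vacuous.
  have key : ∀ n, ∃ Q, UniformlyFair W Q ∧ Approx W n P Q := by
    intro n
    induction n with
    | zero => exact ⟨_, STOP W, .zero _ _ _⟩
    | succ n ih =>
      obtain ⟨Q, hQ, hPQ⟩ := ih
      refine ⟨f Q, hf Q hQ, ?_⟩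
      have := hc n P Q hPQ
      rwa [hP] at this
  refine ⟨Set.eq_empty_iff_forall_notMem.mpr fun s hs => ?_, fun k => ?_⟩
  -- The extra `1` is due to the strict inequality in `Approx`.
  · obtain ⟨Q, hQ, hPQ⟩ := key (count W s.events + 1)
    exact hQ.notMem_D s ((hPQ s (Nat.lt_succ_self _)).2 hs)
  · obtain ⟨Q, hQ, hPQ⟩ := key (k + 1)
    obtain ⟨M, hM⟩ := hQ.bound k
    exact ⟨M, fun s hs hk => hM s ((hPQ s (Nat.lt_succ_of_le hk)).1 hs) hk⟩

end UniformlyFair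

end Proc

end CSP

namespace CSP

-- Events that must precede termination.

namespace Proc

open Trace

variable {E : Type*}

/-- Every terminating trace of `P` contains an event of `V`. -/
def Guarded (V : Set E) (P : Proc E) : Prop :=
  ∀ t : List E, (⟨t, true⟩ : Trace E) ∈ P.T → 0 < count V t

namespace Guarded

variable {V W A : Set E} {P Q : Proc E}

theorem STOP (V : Set E) : Guarded V STOP := by
  rintro t ht
  cases ht

theorem pre (a : E) (h : Guarded V P) : Guarded V (pre a P) := by
  rintro t (ht | ⟨⟨s, b⟩, hs, ht⟩)
  · cases ht
  · obtain ⟨rfl, rfl⟩ := Trace.mk.inj ht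
    exact (h s hs).trans_le (count_le_cons V a s)

theorem pre_of_mem {a : E} (ha : a ∈ V) (P : Proc E) : Guarded V (Proc.pre a P) := by
  rintro t (ht | ⟨⟨s, b⟩, hs, ht⟩)
  · cases ht
  · obtain ⟨rfl, rfl⟩ := Trace.mk.inj ht
    simp [count_cons_mem ha]

theorem choice (h : Guarded V P) (k : Guarded V Q) : Guarded V (choice P Q) :=
  fun t ht => ht.elim (h t) (k t)

theorem seq_left (h : Guarded V P) (Q : Proc E) : Guarded V (seq P Q) := by
  have key : ∀ (t x : List E) (s : Trace E), (⟨t, true⟩ : Trace E) ∈ P.T →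
      (⟨x, true⟩ : Trace E) = app t s → 0 < count V x := by
    rintro t x s ht hx
    obtain ⟨rfl, -⟩ := Trace.mk.inj hx
    exact (h t ht).trans_le (count_le_of_prefix (List.prefix_append _ _))
  rintro x ((⟨-, hx⟩ | ⟨t, s, ht, -, hx⟩) | hx | ⟨t, s, ht, -, hx⟩)
  · cases hx
  · exact key t x s ht hx
  · exact h x (P.D_subset hx)
  · exact key t x s ht hx

/-- A divergence of `P` could be followed by `✓` without `Q` ever starting; hence `hP`. -/
theorem seq_right (hP : P.D = ∅) (h : Guarded V Q) : Guarded V (seq P Q) := by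
  have key : ∀ (t x : List E) (s : Trace E), s ∈ Q.T →
      (⟨x, true⟩ : Trace E) = app t s → 0 < count V x := by
    rintro t x ⟨s, b⟩ hs hx
    obtain ⟨rfl, rfl⟩ := Trace.mk.inj hx
    have := h s hs
    simp only [count_append]
    omega
  rintro x ((⟨-, hx⟩ | ⟨t, s, -, hs, hx⟩) | hx | ⟨t, s, -, hs, hx⟩)
  · cases hx
  · exact key t x s hs hx
  · simp [hP] at hx
  · exact key t x s (Q.D_subset hs) hx

theorem par (h : Guarded V P) (k : Guarded V Q) : Guarded V (par A P Q) := by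
  rintro u (⟨⟨s, b⟩, hs, t, -, hst, htick, -⟩ | ⟨u', ⟨s, -, t, -, hst, hd⟩, r, hx⟩)
  · cases htick
    exact (h s hs).trans_le (hst.count_left_le V)
  · obtain ⟨rfl, -⟩ := Trace.mk.inj hx
    obtain ⟨hst, hs, ht⟩ := hst
    refine lt_of_lt_of_le ?_ (count_le_of_prefix (List.prefix_append u' r.events))
    rcases hd with hd | hd
    · obtain ⟨s, b⟩ := s
      cases hs
      -- A divergence can be extended by `✓` to a terminating trace with the same events, so
      -- guardedness applies to divergences too. Either component may be the diverging one, so both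
      -- must be guarded.
      have := h _ (P.D_subset (P.D_extend s ⟨[], true⟩ hd))
      rw [List.append_nil] at this
      exact this.trans_le (hst.count_left_le V)
    · obtain ⟨t, b⟩ := t
      cases ht
      have := k _ (Q.D_subset (Q.D_extend t ⟨[], true⟩ hd))
      rw [List.append_nil] at this
      exact this.trans_le (hst.count_right_le V)

/-- Termination is synchronised, so without divergences `✓` requires a terminating trace of each
component and one guarded component suffices. -/
theorem par_left (hP : P.D = ∅) (hQ : Q.D = ∅) (h : Guarded V P) :
    Guarded V (Proc.par A P Q) := by
  rintro u (⟨⟨s, b⟩, hs, t, -, hst, htick, -⟩ | ⟨u', ⟨s, -, t, -, hst, hd⟩, r, hx⟩)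
  · cases htick
    exact (h s hs).trans_le (hst.count_left_le V)
  · simp [hP, hQ] at hd

theorem par_right (hP : P.D = ∅) (hQ : Q.D = ∅) (h : Guarded V Q) :
    Guarded V (Proc.par A P Q) := by
  rintro u (⟨s, -, ⟨t, b⟩, ht, hst, -, htick⟩ | ⟨u', ⟨s, -, t, -, hst, hd⟩, r, hx⟩)
  · cases htick
    exact (h t ht).trans_le (hst.count_right_le V)
  · simp [hP, hQ] at hd

/-- Divergence-freedom is required after hiding, because hiding itself can create divergences. -/
theorem hide (hP : (hide A P).D = ∅) (h : Guarded V P) (hA : V ∩ A = ∅) :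
    Guarded V (hide A P) := by
  rintro x (⟨⟨t, b⟩, ht, hx⟩ | hx)
  · obtain ⟨rfl, rfl⟩ := Trace.mk.inj hx
    rw [count_hideList hA]
    exact h t ht
  · exact absurd (hP ▸ hx : (⟨x, true⟩ : Trace E) ∈ (∅ : Set (Trace E))) fun h => h

theorem rename {R : E → E → Prop} (h : Guarded V P) (hR : Term.image R V ⊆ W) :
    Guarded W (rename R P) := by
  rintro x (⟨⟨s, b⟩, hs, hsx, htick⟩ | ⟨y, ⟨s, hs, hsy⟩, r, hx⟩)
  · cases htick
    exact (h s hs).trans_le (count_le_of_forall₂ hR hsx)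
  · obtain ⟨rfl, -⟩ := Trace.mk.inj hx
    have := h _ (P.D_subset (P.D_extend s ⟨[], true⟩ hs))
    rw [List.append_nil] at this
    exact (this.trans_le (count_le_of_forall₂ hR hsy)).trans_le
      (count_le_of_prefix (List.prefix_append _ _))

theorem mono (h : Guarded V P) (hVW : V ⊆ W) : Guarded W P :=
  fun t ht => (h t ht).trans_le (count_mono hVW t)

end Guarded

end Proc

-- Terms as nonexpansive and contractive functions of a variable.

namespace Term

open Proc

variable {E X : Type*} [DecidableEq X]

/-- The interpretation of a term depends only on its free variables. -/
theorem denote_congr (P : Term E X) {ρ ρ' : X → Proc E} (h : ∀ x ∈ P.freeVars, ρ x = ρ' x) :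
    P.denote ρ = P.denote ρ' := by
  induction P generalizing ρ ρ' with
  | STOP | SKIP | DIV => rfl
  | pre a P ih => exact congrArg (Proc.pre a) (ih h)
  | intChoice P Q ihP ihQ | extChoice P Q ihP ihQ =>
    exact congrArg₂ choice (ihP fun x hx => h x (Or.inl hx)) (ihQ fun x hx => h x (Or.inr hx))
  | par A P Q ihP ihQ =>
    exact congrArg₂ (Proc.par A) (ihP fun x hx => h x (Or.inl hx))
      (ihQ fun x hx => h x (Or.inr hx))
  | seq P Q ihP ihQ =>
    exact congrArg₂ Proc.seq (ihP fun x hx => h x (Or.inl hx)) (ihQ fun x hx => h x (Or.inr hx))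
  | hide P A ih => exact congrArg (Proc.hide A) (ih h)
  | rename P R ih => exact congrArg (Proc.rename R) (ih h)
  | var x => exact h x rfl
  | mu x P ih =>
    refine congrArg OrderHom.lfp (OrderHom.ext _ _ (funext fun ξ => ih fun y hy => ?_))
    by_cases hyx : y = x
    · subst hyx; simp
    · simpa [hyx] using h y ⟨hy, hyx⟩

theorem denote_update {P : Term E X} {x : X} (hx : x ∉ P.freeVars) (ρ : X → Proc E)
    (ξ ξ' : Proc E) : P.denote (Function.update ρ x ξ) = P.denote (Function.update ρ x ξ') :=
  P.denote_congr fun y hy => by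
    have : y ≠ x := fun h => hx (h ▸ hy)
    simp [this]

theorem denote_mu (x : X) (P : Term E X) (ρ : X → Proc E) :
    P.denote (Function.update ρ x ((mu x P).denote ρ)) = (mu x P).denote ρ :=
  OrderHom.map_lfp (⟨fun ξ => P.denote (Function.update ρ x ξ),
    fun _ _ h => P.denote.mono (Function.update_mono h)⟩ : Proc E →o Proc E)

/-- As a function of `x`, the term `P` takes processes that agree below `n` occurrences of
`U` to processes that agree below `n + d` occurrences of `V`. -/
def Modulus (d : ℕ) (x : X) (P : Term E X) (U V : Set E) : Prop :=
  ∀ (ρ : X → Proc E) (n : ℕ) (ξ ξ' : Proc E), Approx U n ξ ξ' →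
    Approx V (n + d) (P.denote (Function.update ρ x ξ)) (P.denote (Function.update ρ x ξ'))

namespace Modulus

variable {d : ℕ} {x : X} {P Q : Term E X} {U U' V V' : Set E}

theorem of_notMem (d : ℕ) (hx : x ∉ P.freeVars) (U V : Set E) : Modulus d x P U V := by
  intro ρ n ξ ξ' _
  rw [denote_update hx ρ ξ ξ']
  exact .refl _ _ _

/-- It suffices to check terms in which `x` is free. -/
theorem of_ifFree {S : Set (Set E × Set E)} (hp : (U, V) ∈ ifFree x P S)
    (h : x ∈ P.freeVars → (U, V) ∈ S → Modulus d x P U V) : Modulus d x P U V := by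
  by_cases hx : x ∈ P.freeVars
  · exact h hx (hp hx)
  · exact of_notMem d hx U V

theorem mono (h : Modulus d x P U' V') (hU : U ⊆ U') (hV : V' ⊆ V) : Modulus d x P U V :=
  fun ρ n ξ ξ' hξ => (h ρ n ξ ξ' (hξ.mono_set hU)).mono_set hV

theorem pre (a : E) (h : Modulus d x P U V) : Modulus d x (pre a P) U V :=
  fun ρ n ξ ξ' hξ => (h ρ n ξ ξ' hξ).pre a

theorem intChoice (h : Modulus d x P U V) (k : Modulus d x Q U V) :
    Modulus d x (intChoice P Q) U V :=
  fun ρ n ξ ξ' hξ => (h ρ n ξ ξ' hξ).choice (k ρ n ξ ξ' hξ)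

theorem extChoice (h : Modulus d x P U V) (k : Modulus d x Q U V) :
    Modulus d x (extChoice P Q) U V :=
  fun ρ n ξ ξ' hξ => (h ρ n ξ ξ' hξ).choice (k ρ n ξ ξ' hξ)

theorem par (A : Set E) (h : Modulus d x P U V) (k : Modulus d x Q U V) :
    Modulus d x (par A P Q) U V :=
  fun ρ n ξ ξ' hξ => (h ρ n ξ ξ' hξ).par A (k ρ n ξ ξ' hξ)

theorem seq (h : Modulus d x P U V) (k : Modulus d x Q U V) : Modulus d x (seq P Q) U V :=
  fun ρ n ξ ξ' hξ => (h ρ n ξ ξ' hξ).seq fun _ _ =>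
    (k ρ n ξ ξ' hξ).mono_nat (Nat.sub_le _ _)

/-- The guard spends at least one event of `V` before `Q` starts. Of the budget `n + 1` at most `n`
remains, which nonexpansiveness of `Q` covers. -/
theorem seq_of_guarded (h : Modulus 1 x P U V) (k : Modulus 0 x Q U V)
    (hG : ∀ ρ, Guarded V (P.denote ρ)) : Modulus 1 x (Term.seq P Q) U V :=
  fun ρ n ξ ξ' hξ => (h ρ n ξ ξ' hξ).seq fun t ht =>
    (k ρ n ξ ξ' hξ).mono_nat (by have := hG _ t ht; omega)

theorem hide {A : Set E} (h : Modulus d x P U V) (hA : V ∩ A = ∅) :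
    Modulus d x (hide P A) U V :=
  fun ρ n ξ ξ' hξ => (h ρ n ξ ξ' hξ).hide hA

theorem rename {R : E → E → Prop} (h : Modulus d x P U V') (hR : image R V' ⊆ V) :
    Modulus d x (rename P R) U V :=
  fun ρ n ξ ξ' hξ => (h ρ n ξ ξ' hξ).rename hR

/-- By `Approx.lfp`, changing `x` changes the body only beyond the level `n + d`, uniformly in `y`.
Nonexpansiveness in `y` for the same set `V` on both sides keeps this level through the recursion.
-/
theorem mu {y : X} (hxy : x ≠ y) (h : Modulus d x P U V) (k : Modulus 0 y P V V) :
    Modulus d x (mu y P) U V := by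
  intro ρ n ξ ξ' hξ
  refine Approx.lfp (fun η η' hη => k _ _ η η' hη) fun η => ?_
  have := h (Function.update ρ y η) n ξ ξ' hξ
  rwa [Function.update_comm hxy.symm, Function.update_comm hxy.symm] at this

end Modulus

theorem modulus_of_mem_N (P : Term E X) {x : X} {U V : Set E} (h : (U, V) ∈ N x P) :
    Modulus 0 x P U V := by
  induction P generalizing x U V with
  | STOP | SKIP | DIV => exact .of_notMem 0 (Set.notMem_empty x) U V
  | pre a P ih => exact .of_ifFree h fun _ h => (ih h).pre a
  | intChoice P Q ihP ihQ => exact .of_ifFree h fun _ h => (ihP h.1).intChoice (ihQ h.2)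
  | extChoice P Q ihP ihQ => exact .of_ifFree h fun _ h => (ihP h.1).extChoice (ihQ h.2)
  | par A P Q ihP ihQ => exact .of_ifFree h fun _ h => (ihP h.1).par A (ihQ h.2)
  | seq P Q ihP ihQ => exact .of_ifFree h fun _ h => (ihP h.1).seq (ihQ h.2)
  | hide P A ih =>
    refine .of_ifFree h fun _ ⟨V', h, hA, hV⟩ => ?_
    exact ((ih h).hide hA).mono subset_rfl hV
  | rename P R ih => exact .of_ifFree h fun _ ⟨V', h, hR⟩ => (ih h).rename hR
  | var y =>
    refine .of_ifFree (S := {p | p.1 ⊆ p.2}) h fun hx hUV ρ n ξ ξ' hξ => ?_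
    obtain rfl : x = y := hx
    change Approx V n (Function.update ρ x ξ x) (Function.update ρ x ξ' x)
    simpa using hξ.mono_set hUV
  | mu y P ih =>
    refine .of_ifFree h fun hx ⟨U', V', h, k, hU, hV⟩ => ?_
    exact ((ih h).mu hx.2 (ih k)).mono hU hV

-- Preservation of fairness and joint soundness of the analyses.

/-- If all free variables of `P` denote `U`-fair livelock-free processes, then `P` denotes
a `V`-fair livelock-free process. -/
def PreservesFair (P : Term E X) (U V : Set E) : Prop :=
  ∀ ρ : X → Proc E, (∀ x ∈ P.freeVars, UniformlyFair U (ρ x)) → UniformlyFair V (P.denote ρ)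

theorem PreservesFair.uniformlyFair {P : Term E X} {U V : Set E} (h : PreservesFair P U V)
    (hP : P.IsClosed) (ρ : X → Proc E) : UniformlyFair V (P.denote ρ) :=
  h ρ fun x hx => (hP ▸ hx : x ∈ (∅ : Set X)).elim

/-- Any fair pair will do: for a closed term its first component imposes no condition, and its
second is not needed for the absence of divergences. -/
theorem D_eq_of_closed {P : Term E X} (hF : ∀ U V, (U, V) ∈ F P → PreservesFair P U V)
    (hP : P.IsClosed ∧ F P ≠ ∅) (ρ : X → Proc E) : (P.denote ρ).D = ∅ := by
  obtain ⟨⟨U, V⟩, hUV⟩ := Set.nonempty_iff_ne_empty.mpr hP.2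
  exact ((hF U V hUV).uniformlyFair hP.1 ρ).D_eq

/-- The joint soundness of guard, contractive and fair sets. -/
structure Sound (P : Term E X) : Prop where
  guarded : ∀ V ∈ G P, ∀ ρ, Guarded V (P.denote ρ)
  contractive : ∀ x U V, (U, V) ∈ C P x → Modulus 1 x P U V
  fair : ∀ U V, (U, V) ∈ F P → PreservesFair P U V

namespace Sound

variable {P Q : Term E X}

theorem STOP : Sound (STOP : Term E X) where
  guarded _ _ _ := .STOP _
  contractive x U V _ := .of_notMem 1 (Set.notMem_empty x) U V
  fair _ _ _ _ _ := .STOP _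

theorem SKIP : Sound (SKIP : Term E X) where
  guarded V h := by simp [G] at h
  contractive x U V _ := .of_notMem 1 (Set.notMem_empty x) U V
  fair _ _ _ _ _ := .SKIP _

theorem DIV : Sound (DIV : Term E X) where
  guarded V h := by simp [G] at h
  contractive x U V _ := .of_notMem 1 (Set.notMem_empty x) U V
  fair U V h := by simp [F] at h

theorem var (x : X) : Sound (var x : Term E X) where
  guarded V h := by simp [G] at h
  contractive y U V h := by
    rw [C] at h
    exact .of_ifFree h fun _ h => h.elim
  fair U V h ρ hρ := by
    rw [F] at h
    exact (hρ x rfl).mono h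

theorem pre (a : E) (hP : Sound P) : Sound (pre a P) where
  guarded V h ρ := by
    rw [G] at h
    rcases h with h | h
    · exact (hP.guarded V h ρ).pre a
    · exact .pre_of_mem (show a ∈ V from h) _
  contractive x U V h := by
    rw [C] at h
    refine .of_ifFree h fun _ h => ?_
    rcases h with h | ⟨h, ha⟩
    · exact (hP.contractive x U V h).pre a
    · exact fun ρ n ξ ξ' hξ => (modulus_of_mem_N P h ρ n ξ ξ' hξ).pre_succ ha
  fair U V h ρ hρ := by
    rw [F] at h
    exact (hP.fair U V h ρ hρ).pre a

theorem intChoice (hP : Sound P) (hQ : Sound Q) : Sound (intChoice P Q) where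
  guarded V h ρ := by
    rw [G] at h
    exact (hP.guarded V h.1 ρ).choice (hQ.guarded V h.2 ρ)
  contractive x U V h := by
    rw [C] at h
    exact .of_ifFree h fun _ h => (hP.contractive x U V h.1).intChoice (hQ.contractive x U V h.2)
  fair U V h ρ hρ := by
    rw [F] at h
    exact (hP.fair U V h.1 ρ fun x hx => hρ x (Or.inl hx)).choice
      (hQ.fair U V h.2 ρ fun x hx => hρ x (Or.inr hx))

theorem extChoice (hP : Sound P) (hQ : Sound Q) : Sound (extChoice P Q) where
  guarded V h ρ := by
    rw [G] at h
    exact (hP.guarded V h.1 ρ).choice (hQ.guarded V h.2 ρ)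
  contractive x U V h := by
    rw [C] at h
    exact .of_ifFree h fun _ h => (hP.contractive x U V h.1).extChoice (hQ.contractive x U V h.2)
  fair U V h ρ hρ := by
    rw [F] at h
    exact (hP.fair U V h.1 ρ fun x hx => hρ x (Or.inl hx)).choice
      (hQ.fair U V h.2 ρ fun x hx => hρ x (Or.inr hx))

theorem seq (hP : Sound P) (hQ : Sound Q) : Sound (seq P Q) where
  guarded V h ρ := by
    rw [G] at h
    split_ifs at h with hcl
    · rcases h with h | h
      · exact (hP.guarded V h ρ).seq_left _
      · exact (hQ.guarded V h ρ).seq_right (D_eq_of_closed hP.fair hcl ρ)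
    · exact (hP.guarded V h ρ).seq_left _
  contractive x U V h := by
    rw [C] at h
    refine .of_ifFree h fun _ h => ?_
    rcases h with ⟨h, k | ⟨k, hG⟩⟩
    · exact (hP.contractive x U V h).seq (hQ.contractive x U V k)
    · exact (hP.contractive x U V h).seq_of_guarded (modulus_of_mem_N Q k) (hP.guarded V hG)
  fair U V h ρ hρ := by
    rw [F] at h
    exact (hP.fair U V h.1 ρ fun x hx => hρ x (Or.inl hx)).seq
      (hQ.fair U V h.2 ρ fun x hx => hρ x (Or.inr hx))

theorem par (A : Set E) (hP : Sound P) (hQ : Sound Q) : Sound (par A P Q) where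
  guarded V h ρ := by
    rw [G] at h
    split_ifs at h with hcl
    · have h1 := D_eq_of_closed hP.fair hcl.1 ρ
      have h2 := D_eq_of_closed hQ.fair hcl.2 ρ
      rcases h with h | h
      · exact .par_left h1 h2 (hP.guarded V h ρ)
      · exact .par_right h1 h2 (hQ.guarded V h ρ)
    · exact (hP.guarded V h.1 ρ).par (hQ.guarded V h.2 ρ)
  contractive x U V h := by
    rw [C] at h
    exact .of_ifFree h fun _ h => (hP.contractive x U V h.1).par A (hQ.contractive x U V h.2)
  fair U V h ρ hρ := by
    rw [F] at h
    -- Fairness for `U` implies fairness for any larger set. Processes fair for `U₁ ∩ U₂` thus meet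
    -- the assumptions of both components.
    have h1 : ∀ W V', U ⊆ W → (W, V') ∈ F P → UniformlyFair V' (P.denote ρ) :=
      fun W V' hU hW => hP.fair W V' hW ρ fun x hx => (hρ x (Or.inl hx)).mono hU
    have h2 : ∀ W V', U ⊆ W → (W, V') ∈ F Q → UniformlyFair V' (Q.denote ρ) :=
      fun W V' hU hW => hQ.fair W V' hW ρ fun x hx => (hρ x (Or.inr hx)).mono hU
    rcases h with (h | ⟨U₁, U₂, hU, h, k⟩) | ⟨U₁, U₂, hU, h, k⟩
    · exact (h1 U V subset_rfl h.1).par (h2 U V subset_rfl h.2)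
    · exact (h1 U₁ V (hU ▸ Set.inter_subset_left) h).par_left
        (h2 U₂ A (hU ▸ Set.inter_subset_right) k)
    · exact (h1 U₁ A (hU ▸ Set.inter_subset_left) k).par_right
        (h2 U₂ V (hU ▸ Set.inter_subset_right) h)

theorem hide (hP : Sound P) (A : Set E) : Sound (hide P A) where
  guarded V h ρ := by
    rw [G] at h
    split_ifs at h with hcl
    · obtain ⟨V', h, hA, hV⟩ := h
      -- Fairness for the complement of `A` prevents infinite traces from ending inside `A`, so
      -- hiding `A` introduces no divergence.
      have hD := (((hP.fair _ _ hcl.2).uniformlyFair hcl.1 ρ).hide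
        (Set.compl_inter_self A)).D_eq
      exact ((hP.guarded V' h ρ).hide hD hA).mono hV
    · exact h.elim
  contractive x U V h := by
    rw [C] at h
    refine .of_ifFree h fun _ ⟨V', h, hA, hV⟩ => ?_
    exact ((hP.contractive x U V' h).hide hA).mono subset_rfl hV
  fair U V h ρ hρ := by
    rw [F] at h
    obtain ⟨V', h, hA, hV⟩ := h
    exact ((hP.fair U V' h ρ hρ).hide hA).mono hV

theorem rename (hP : Sound P) (R : E → E → Prop) : Sound (rename P R) where
  guarded V h ρ := by
    rw [G] at h
    obtain ⟨V', h, hR⟩ := h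
    exact (hP.guarded V' h ρ).rename hR
  contractive x U V h := by
    rw [C] at h
    exact .of_ifFree h fun _ ⟨V', h, hR⟩ => (hP.contractive x U V' h).rename hR
  fair U V h ρ hρ := by
    rw [F] at h
    obtain ⟨V', h, hR⟩ := h
    exact (hP.fair U V' h ρ hρ).rename hR

theorem mu (x : X) (hP : Sound P) : Sound (mu x P) where
  guarded V h ρ := by
    rw [G] at h
    -- One unfolding suffices: guardedness of the body holds for every value of `x`, in particular
    -- for the fixed point.
    rw [← denote_mu]
    exact hP.guarded V h _
  contractive y U V h := by
    rw [C] at h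
    refine .of_ifFree h fun hy ⟨U', V', h, k, hU, hV⟩ => ?_
    exact ((hP.contractive y U' V' h).mu hy.2 (modulus_of_mem_N P k)).mono hU hV
  fair U V h ρ hρ := by
    have key : ∀ W, (W, W) ∈ C P x ∩ F P →
        (∀ y ∈ (Term.mu x P).freeVars, UniformlyFair W (ρ y)) →
        UniformlyFair W ((Term.mu x P).denote ρ) := by
      intro W hW hρ
      -- Contraction and preservation of fairness must refer to the same set `W` on both sides so
      -- that they can be iterated.
      refine .of_contractive (f := fun ξ => P.denote (Function.update ρ x ξ)) (denote_mu x P ρ)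
        (fun n ξ ξ' hξ => hP.contractive x W W hW.1 ρ n ξ ξ' hξ) fun ξ hξ => ?_
      refine hP.fair W W hW.2 _ fun y hy => ?_
      by_cases hyx : y = x
      · subst hyx; simpa using hξ
      · simpa [hyx] using hρ y ⟨hy, hyx⟩
    rw [F] at h
    split_ifs at h with hcl
    · obtain ⟨W, hW, hV⟩ := h
      exact (key W hW fun y hy => (hcl ▸ hy : y ∈ (∅ : Set X)).elim).mono hV
    · obtain ⟨W, hW, hU, hV⟩ := h
      exact (key W hW fun y hy => (hρ y hy).mono hU).mono hV

end Sound

theorem sound (P : Term E X) : Sound P := by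
  induction P with
  | STOP => exact .STOP
  | SKIP => exact .SKIP
  | DIV => exact .DIV
  | var x => exact .var x
  | pre a P ih => exact ih.pre a
  | intChoice P Q ihP ihQ => exact ihP.intChoice ihQ
  | extChoice P Q ihP ihQ => exact ihP.extChoice ihQ
  | par A P Q ihP ihQ => exact .par A ihP ihQ
  | seq P Q ihP ihQ => exact ihP.seq ihQ
  | hide P A ih => exact ih.hide A
  | rename P R ih => exact ih.rename R
  | mu x P ih => exact .mu x ih

end Term

end CSP

theorem proposition5p4 {E X : Type*} [Finite E] [DecidableEq X]
    (P : CSP.Term E X) {n : ℕ} (x : Fin n → X) (hx : Function.Injective x)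
    (hfree : P.freeVars ⊆ Set.range x)
    {U V : Set E} (hUV : (U, V) ∈ P.F)
    (θ : Fin n → CSP.Proc E) (hlive : ∀ i, (θ i).LivelockFree) (hfair : ∀ i, (θ i).Fair U) :
    (P.subst x θ).LivelockFree ∧ (P.subst x θ).Fair V := by
  have h : CSP.Proc.UniformlyFair V (P.subst x θ) := by
    refine P.sound.fair U V hUV _ fun y hy => ?_
    obtain ⟨i, rfl⟩ := hfree hy
    rw [hx.extend_apply]
    -- Finiteness of the alphabet enters here only, through König's lemma.
    exact .of_fair (hlive i) (hfair i)
  exact ⟨h.D_eq, h.fair⟩
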